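/- Notation. Let $X_t\in\mathbb R^r$, $t\ge 0$, be a strictly stationary process with $X_t\in L^4$, mean $\mu$ and lagged covariance matrices $K(u)=\mathbb E(X_tX_{t+u}^*)-\mu\mu^*$, $u\ge 0$. For a vector or matrix $M$ let $\|M\|=\max_{i,j}|M_{i,j}|$, and for a random one let $\|M\|_p=(\mathbb E\|M\|^p)^{1/p}$. Let $f$ be a positive, continuous, decreasing function on $(0,\infty)$ with $I(f)=\int_1^\infty f(T)\,dT<\infty$. The process $X$ has integrable decorrelation rate $f$ if $|\mathbb E(GH)-\mathbb E(G)\mathbb E(H)|\le f(T)$ for any two time intervals $U,V\subset[0,\infty)$ with time gap $T=\inf_{u\in U,\,v\in V}(v-u)>0$, whenever $G$ is of the form $X_s(i)$ or $X_s(i)X_t(j)$ with $s,t\in U$, and $H$ is of the same form with times in $V$. Call $X$ admissible if it is strictly stationary, lies in $L^4$, has locally Lipschitz $u\mapsto K(u)$ on $[0,\infty)$ and has an integrable decorrelation rate. For $N=N(\varepsilon)\in\mathbb N$, $\Delta=\Delta(\varepsilon)>0$ and $u\ge 0$, let $\kappa$ be the integer closest to $u/\Delta$ and put $$\hat K_X^\varepsilon(u)=\frac1N\sum_{n=1}^N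 X_{n\Delta}X_{(n+\kappa)\Delta}^*-\Big(\frac1N\sum_{n=1}^N X_{n\Delta}\Big)\Big(\frac1N\sum_{n=1}^N X_{(n+\kappa)\Delta}\Big)^*.$$ Proposition. (1) Let $X$ be admissible with decorrelation rate $f$, let $\nu$ be an upper bound of $\|X_t\|_4$, let $A\ge 0$, and let $\lambda$ be a Lipschitz constant of (the entries of) $K$ on $[0,A+1]$. Let $N(\varepsilon)\to\infty$ as $\varepsilon\to0^+$ be arbitrary, and let $\Delta(\varepsilon)>0$ satisfy $\Delta(\varepsilon)N(\varepsilon)^{1/3}\to c$ for some $c\in(0,\infty)$. Then there is a constant $C$, depending only on $r,A,\nu,\lambda,c$ and (an upper bound of) $I(f)$, such that for all sufficiently small $\varepsilon>0$ $$\|\hat K_X^\varepsilon(u)-K(u)\|_2\le \frac{C}{N(\varepsilon)^{1/3}}\qquad\text{for all }0\le u\le A .$$ (2) Up to multiplicative constants, this uniform speed is the best obtainable under these assumptions, for any choice of the time steps: for every $r\ge1$ there is an admissible Gaussian process $X$ in $\mathbb R^r$ such that for every $A>0$ there is a constant $c'>0$ with the following property. For all $N(\varepsilon)\in\mathbb N$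 and $\Delta(\varepsilon)>0$ with $\Delta(\varepsilon)\to0$ and $N(\varepsilon)\Delta(\varepsilon)\to\infty$ as $\varepsilon\to0^+$, one has, for all sufficiently small $\varepsilon>0$, $$\sup_{0\le u\le A}\|\hat K_X^\varepsilon(u)-K(u)\|_2\ge \frac{c'}{N(\varepsilon)^{1/3}} .$$ -/

import Mathlib

open MeasureTheory ProbabilityTheory Filter Set
open scoped Topology NNReal ENNReal

universe v

/-- The index set of time is `[0, ∞)`: a process is a family `X t`, and only the values at
`t ≥ 0` matter. Strict stationarity: the finite-dimensional laws at nonnegative times are invariant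
under shifts to the right. -/
def IsStrictlyStationary {Ω : Type*} [MeasurableSpace Ω] {r : ℕ} (P : Measure Ω)
    (X : ℝ → Ω → Fin r → ℝ) : Prop :=
  ∀ (n : ℕ) (t : Fin n → ℝ) (h : ℝ), (∀ k, 0 ≤ t k) → 0 ≤ h →
    P.map (fun ω k => X (t k + h) ω) = P.map (fun ω k => X (t k) ω)

/-- The lagged covariance matrix `K(u) = E(X_0 X_u^*) - μ μ^*` with `μ = E(X_0)`. -/
noncomputable def laggedCov {Ω : Type*} [MeasurableSpace Ω] {r : ℕ} (P : Measure Ω)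
    (X : ℝ → Ω → Fin r → ℝ) (u : ℝ) : Matrix (Fin r) (Fin r) ℝ :=
  Matrix.of fun i j =>
    (∫ ω, X 0 ω i * X u ω j ∂P) - (∫ ω, X 0 ω i ∂P) * (∫ ω, X 0 ω j ∂P)

/-- The set `F_U` of all random variables `X_s(i)` and `X_s(i) X_t(j)` with `s, t ∈ U`. -/
def lagMonomials {Ω : Type*} {r : ℕ} (X : ℝ → Ω → Fin r → ℝ) (U : Set ℝ) : Set (Ω → ℝ) :=
  {G | (∃ s ∈ U, ∃ i, G = fun ω => X s ω i) ∨
    (∃ s ∈ U, ∃ t ∈ U, ∃ i j, G = fun ω => X s ω i * X t ω j)}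

/-- `X` has integrable decorrelation rate `f`: `f` is positive, continuous and decreasing on
`(0, ∞)`, integrable on `[1, ∞)`, and it bounds the covariances between `F_U` and `F_V`
for any two time intervals `U`, `V` separated by a time gap `T = inf (v - u) > 0`. -/
structure HasIntegrableDecorrelationRate {Ω : Type*} [MeasurableSpace Ω] {r : ℕ} (P : Measure Ω)
    (X : ℝ → Ω → Fin r → ℝ) (f : ℝ → ℝ) : Prop where
  pos : ∀ T, 0 < T → 0 < f T
  antitone : AntitoneOn f (Ioi 0)
  continuous : ContinuousOn f (Ioi 0)
  integrable : IntegrableOn f (Ioi 1)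
  decorrelation : ∀ (U V : Set ℝ) (T : ℝ), U ⊆ Ici 0 → V ⊆ Ici 0 →
    U.OrdConnected → V.OrdConnected → U.Nonempty → V.Nonempty →
    0 < T → IsGLB {d : ℝ | ∃ u ∈ U, ∃ v ∈ V, d = v - u} T →
    ∀ G ∈ lagMonomials X U, ∀ H ∈ lagMonomials X V,
      |(∫ ω, G ω * H ω ∂P) - (∫ ω, G ω ∂P) * (∫ ω, H ω ∂P)| ≤ f T

/-- The standing assumptions on the process: strictly stationary, in `L^4`, with locally Lipschitz
lagged covariances and integrable decorrelation rate `f`. -/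
structure IsAdmissibleProcess {Ω : Type*} [MeasurableSpace Ω] {r : ℕ} (P : Measure Ω)
    (X : ℝ → Ω → Fin r → ℝ) (f : ℝ → ℝ) : Prop where
  stationary : IsStrictlyStationary P X
  memLp : ∀ t, 0 ≤ t → MemLp (X t) 4 P
  locallyLipschitz : ∀ i j, LocallyLipschitzOn (Ici 0) (fun u => laggedCov P X u i j)
  decorrelation : HasIntegrableDecorrelationRate P X f

/-- An adaptive sub-sampling scheme: `Δ(ε) > 0`, `Δ(ε) → 0` and `N(ε) Δ(ε) → ∞` as `ε → 0+`. -/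
structure IsAdaptiveScheme (N : ℝ → ℕ) (Δ : ℝ → ℝ) : Prop where
  pos : ∀ ε, 0 < ε → 0 < Δ ε
  tendsto_zero : Tendsto Δ (𝓝[>] 0) (𝓝 0)
  tendsto_atTop : Tendsto (fun ε => (N ε : ℝ) * Δ ε) (𝓝[>] 0) atTop

/-- The sub-sampled empirical mean `(1/N) ∑_{n=1}^N X_{(n+κ)Δ}`, shifted by `κ` time steps. -/
noncomputable def shiftedMean {Ω : Type*} {r : ℕ} (X : ℝ → Ω → Fin r → ℝ)
    (N : ℕ) (Δ : ℝ) (κ : ℤ) (ω : Ω) : Fin r → ℝ :=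
  (1 / (N : ℝ)) • ∑ n ∈ Finset.Icc 1 N, X (((n : ℝ) + (κ : ℝ)) * Δ) ω

/-- The sub-sampled empirical lagged covariance matrix at lag `u`, where `κ` is the integer closest
to `u / Δ`. -/
noncomputable def empiricalCov {Ω : Type*} {r : ℕ} (X : ℝ → Ω → Fin r → ℝ)
    (N : ℕ) (Δ u : ℝ) (ω : Ω) : Matrix (Fin r) (Fin r) ℝ :=
  (1 / (N : ℝ)) • (∑ n ∈ Finset.Icc 1 N,
      Matrix.vecMulVec (X ((n : ℝ) * Δ) ω) (X (((n : ℝ) + (round (u / Δ) : ℝ)) * Δ) ω))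
    - Matrix.vecMulVec (shiftedMean X N Δ 0 ω) (shiftedMean X N Δ (round (u / Δ)) ω)

/-- `‖M‖_2 = (E ‖M‖²)^{1/2}` for a random matrix, where `‖M‖` is the largest absolute value of
the entries (the norm of the product space `Fin r → Fin r → ℝ`). -/
noncomputable def matrixL2Norm {Ω : Type*} [MeasurableSpace Ω] {r : ℕ} (P : Measure Ω)
    (M : Ω → Matrix (Fin r) (Fin r) ℝ) : ℝ≥0∞ :=
  eLpNorm (fun ω => (Matrix.of.symm (M ω) : Fin r → Fin r → ℝ)) 2 P

/-- The `L^2` estimation error `‖K̂_X(u) - K(u)‖_2` for `N` observations with time step `Δ`. -/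
noncomputable def covError {Ω : Type*} [MeasurableSpace Ω] {r : ℕ} (P : Measure Ω)
    (X : ℝ → Ω → Fin r → ℝ) (N : ℕ) (Δ u : ℝ) : ℝ≥0∞ :=
  matrixL2Norm P (fun ω => empiricalCov X N Δ u ω - laggedCov P X u)

/-!
The estimation error is a random fluctuation plus a rounding bias. By stationarity and the
integrable decorrelation rate, the covariances of the observations, and of their lagged products,
are summable over the grid of step `Δ`, so their empirical means have variance `O(1 / (N Δ))`. The
product of the two empirical means is controlled by a fourth moment: in `E (∑ Y_n) ^ 4` each
`4`-tuple of indices is sorted, and the rate is applied across the gaps of the sorted tuple. The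
bias is at most `L Δ`, because the lag is moved by at most `Δ` when it is rounded to the grid.
Fluctuation `(N Δ) ^ (-1 / 2)` and bias `Δ` balance at `Δ ~ N ^ (-1 / 3)`.

For the converse, unit moving averages of white noise have a triangular covariance. At the lag
`3 Δ / 4` rounding produces a bias of at least `Δ / 4`, while at the lag `0` the Gaussian
fluctuations alone produce a mean square error of order at least `1 / (N Δ)`. A large `Δ` is thus
penalised by the first and a small one by the second, and one of the two errors is always of order
at least `N ^ (-1 / 3)`.
-/

section DecayEnvelope

/-- A bound for a covariance as a function of the time lag: nonnegative, decreasing and integrable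
on the half-line `[0, ∞)`. -/
structure IsDecayEnvelope (g : ℝ → ℝ) : Prop where
  nonneg : ∀ x, 0 ≤ x → 0 ≤ g x
  antitoneOn : AntitoneOn g (Ici 0)
  integrableOn : IntegrableOn g (Ioi 0)

lemma sum_abs_sub_le_two_mul_sum_range {φ : ℝ → ℝ} (hφ : ∀ x, 0 ≤ x → 0 ≤ φ x) {N a : ℕ}
    (ha : a ∈ Finset.Icc 1 N) :
    ∑ b ∈ Finset.Icc 1 N, φ |(a : ℝ) - b| ≤ 2 * ∑ k ∈ Finset.range N, φ k := by
  have hdist : ∀ b : ℕ, |(a : ℝ) - b| = (((a : ℤ) - b).natAbs : ℕ) := fun b => by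
    rw [Nat.cast_natAbs]; push_cast; rfl
  have hinj : ∀ s ⊆ Finset.Icc 1 N, InjOn (fun b : ℕ => ((a : ℤ) - b).natAbs) s →
      ∑ b ∈ s, φ |(a : ℝ) - b| ≤ ∑ k ∈ Finset.range N, φ k := fun s hs hinj => by
    simp only [hdist]
    rw [← Finset.sum_image (g := fun b : ℕ => ((a : ℤ) - b).natAbs) (f := fun k : ℕ => φ k) hinj]
    refine Finset.sum_le_sum_of_subset_of_nonneg (fun k hk => ?_) fun k _ _ => hφ k k.cast_nonneg
    obtain ⟨b, hb, rfl⟩ := Finset.mem_image.1 hk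
    have := Finset.mem_Icc.1 (hs hb)
    have := Finset.mem_Icc.1 ha
    exact Finset.mem_range.2 (by lia)
  rw [two_mul, ← Finset.sum_filter_add_sum_filter_not _ (fun b => b ≤ a)]
  refine add_le_add (hinj _ (Finset.filter_subset _ _) ?_) (hinj _ (Finset.filter_subset _ _) ?_)
  all_goals
    intro b hb c hc h
    simp only [Finset.coe_filter, mem_ofPred_eq] at hb hc h
    lia

namespace IsDecayEnvelope

variable {g : ℝ → ℝ} {Δ : ℝ}

lemma sum_range_le (hg : IsDecayEnvelope g) (hΔ : 0 < Δ) (N : ℕ) :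
    ∑ k ∈ Finset.range N, g (k * Δ) ≤ g 0 + (∫ x in Ioi 0, g x) / Δ := by
  have hnonneg : ∀ᵐ x ∂volume.restrict (Ioi 0), 0 ≤ g x :=
    ae_restrict_of_forall_mem measurableSet_Ioi fun x hx => hg.nonneg x (le_of_lt hx)
  cases N with
  | zero =>
    simpa using add_nonneg (hg.nonneg 0 le_rfl)
      (div_nonneg (integral_nonneg_of_ae hnonneg) hΔ.le)
  | succ n =>
    have hanti : AntitoneOn (fun x : ℝ => g (x * Δ)) (Icc ((0 : ℕ) : ℝ) n) :=
      fun x hx y hy hxy => by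
        have hmem : ∀ {z : ℝ}, z ∈ Icc ((0 : ℕ) : ℝ) n → z * Δ ∈ Ici 0 := fun hz =>
          mul_nonneg (Nat.cast_nonneg 0 |>.trans hz.1) hΔ.le
        exact hg.antitoneOn (hmem hx) (hmem hy) (by gcongr)
    have hsum := hanti.sum_le_integral_Ico n.zero_le
    rw [intervalIntegral.integral_comp_mul_right _ hΔ.ne', smul_eq_mul, inv_mul_eq_div,
      ← Finset.range_eq_Ico, Nat.cast_zero, zero_mul,
      intervalIntegral.integral_of_le (by positivity)] at hsum
    rw [Finset.sum_range_succ', add_comm]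
    refine add_le_add (by simp) (hsum.trans ?_)
    refine div_le_div_of_nonneg_right ?_ hΔ.le
    exact setIntegral_mono_set hg.integrableOn hnonneg
      (Ioc_subset_Ioi_self (α := ℝ)).eventuallyLE

lemma sum_sum_le (hg : IsDecayEnvelope g) (hΔ : 0 < Δ) (N : ℕ) :
    ∑ a ∈ Finset.Icc 1 N, ∑ b ∈ Finset.Icc 1 N, g (|(a : ℝ) - b| * Δ)
      ≤ N * (2 * (g 0 + (∫ x in Ioi 0, g x) / Δ)) := by
  calc ∑ a ∈ Finset.Icc 1 N, ∑ b ∈ Finset.Icc 1 N, g (|(a : ℝ) - b| * Δ)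
      ≤ ∑ _a ∈ Finset.Icc 1 N, 2 * (g 0 + (∫ x in Ioi 0, g x) / Δ) :=
        Finset.sum_le_sum fun a ha =>
          (sum_abs_sub_le_two_mul_sum_range (φ := fun x => g (x * Δ))
            (fun x hx => hg.nonneg _ (by positivity)) ha).trans
            (mul_le_mul_of_nonneg_left (hg.sum_range_le hΔ N) zero_le_two)
    _ = N * (2 * (g 0 + (∫ x in Ioi 0, g x) / Δ)) := by simp

end IsDecayEnvelope

/-- Turns a decorrelation rate `f`, defined for positive gaps, into an envelope on `[0, ∞)` when
the gap is only known to be at least `x - B` at lag `x`: the trivial bound `M` is used up to lag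
`B + 1`, and as a cap beyond. -/
noncomputable def rateEnvelope (f : ℝ → ℝ) (M B x : ℝ) : ℝ :=
  if x ≤ B + 1 then M else min M (f (x - B))

section rateEnvelope

variable {f : ℝ → ℝ} {M B x : ℝ}

lemma rateEnvelope_of_le (hx : x ≤ B + 1) : rateEnvelope f M B x = M := if_pos hx

lemma rateEnvelope_of_lt (hx : B + 1 < x) : rateEnvelope f M B x = min M (f (x - B)) :=
  if_neg hx.not_ge

lemma antitone_rateEnvelope (hanti : AntitoneOn f (Ioi 0)) : Antitone (rateEnvelope f M B) := by
  intro x y hxy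
  rcases le_or_gt x (B + 1) with hx | hx
  · rw [rateEnvelope_of_le hx, rateEnvelope]
    split_ifs
    exacts [le_rfl, min_le_left _ _]
  · rw [rateEnvelope_of_lt hx, rateEnvelope_of_lt (hx.trans_le hxy)]
    exact min_le_min le_rfl
      (hanti (mem_Ioi.2 (by linarith)) (mem_Ioi.2 (by linarith)) (by linarith))

lemma rateEnvelope_nonneg (hpos : ∀ T, 0 < T → 0 < f T) (hM : 0 ≤ M) :
    0 ≤ rateEnvelope f M B x := by
  unfold rateEnvelope
  split_ifs with h
  · exact hM
  · exact le_min hM (hpos _ (by linarith)).le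

lemma integrableOn_comp_sub_right (hint : IntegrableOn f (Ioi 1)) :
    IntegrableOn (fun x => f (x - B)) (Ioi (B + 1)) := by
  have := ((measurePreserving_sub_right volume B).integrableOn_comp_preimage
    (MeasurableEquiv.subRight B).measurableEmbedding (f := f) (s := Ioi 1)).2 hint
  simpa [preimage_sub_const_Ioi, add_comm, Function.comp_def] using this

lemma setIntegral_comp_sub_right :
    ∫ x in Ioi (B + 1), f (x - B) = ∫ x in Ioi 1, f x := by
  have := (measurePreserving_sub_right volume B).setIntegral_preimage_emb
    (MeasurableEquiv.subRight B).measurableEmbedding f (Ioi 1)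
  simpa [preimage_sub_const_Ioi, add_comm] using this

lemma integrableOn_rateEnvelope (hpos : ∀ T, 0 < T → 0 < f T) (hanti : AntitoneOn f (Ioi 0))
    (hint : IntegrableOn f (Ioi 1)) (hM : 0 ≤ M) :
    IntegrableOn (rateEnvelope f M B) (Ioi (B + 1)) := by
  refine (integrableOn_comp_sub_right hint (B := B)).mono'
    (antitone_rateEnvelope hanti).measurable.aestronglyMeasurable ?_
  filter_upwards [ae_restrict_mem measurableSet_Ioi] with x hx
  rw [Real.norm_of_nonneg (rateEnvelope_nonneg hpos hM), rateEnvelope_of_lt hx]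
  exact min_le_right _ _

lemma isDecayEnvelope_rateEnvelope (hpos : ∀ T, 0 < T → 0 < f T) (hanti : AntitoneOn f (Ioi 0))
    (hint : IntegrableOn f (Ioi 1)) (hM : 0 ≤ M) (hB : 0 ≤ B) :
    IsDecayEnvelope (rateEnvelope f M B) where
  nonneg _ _ := rateEnvelope_nonneg hpos hM
  antitoneOn := (antitone_rateEnvelope hanti).antitoneOn _
  integrableOn := by
    rw [← Ioc_union_Ioi_eq_Ioi (show (0 : ℝ) ≤ B + 1 by linarith)]
    refine IntegrableOn.union ?_ (integrableOn_rateEnvelope hpos hanti hint hM)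
    exact (integrableOn_const (by simp)).congr_fun
      (fun x hx => (rateEnvelope_of_le hx.2).symm) measurableSet_Ioc

lemma setIntegral_rateEnvelope_le (hpos : ∀ T, 0 < T → 0 < f T) (hanti : AntitoneOn f (Ioi 0))
    (hint : IntegrableOn f (Ioi 1)) (hM : 0 ≤ M) (hB : 0 ≤ B) :
    ∫ x in Ioi 0, rateEnvelope f M B x ≤ M * (B + 1) + ∫ T in Ioi 1, f T := by
  have hB1 : (0 : ℝ) ≤ B + 1 := by linarith
  have henv := (isDecayEnvelope_rateEnvelope hpos hanti hint hM hB).integrableOn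
  rw [← Ioc_union_Ioi_eq_Ioi hB1] at henv ⊢
  rw [setIntegral_union Ioc_disjoint_Ioi_same measurableSet_Ioi henv.left_of_union
    henv.right_of_union, ← setIntegral_comp_sub_right (f := f) (B := B)]
  refine add_le_add (le_of_eq ?_) ?_
  · rw [setIntegral_congr_fun measurableSet_Ioc fun x hx => rateEnvelope_of_le hx.2]
    simp [hB1, mul_comm]
  · refine setIntegral_mono_on henv.right_of_union (integrableOn_comp_sub_right hint)
      measurableSet_Ioi fun x hx => ?_
    rw [rateEnvelope_of_lt hx]
    exact min_le_right _ _

lemma rateEnvelope_zero_add_integral_div_le (hpos : ∀ T, 0 < T → 0 < f T)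
    (hanti : AntitoneOn f (Ioi 0)) (hint : IntegrableOn f (Ioi 1)) (hM : 0 ≤ M) (hB : 0 ≤ B)
    {Δ : ℝ} (hΔ : 0 < Δ) (hΔ1 : Δ ≤ 1) :
    rateEnvelope f M B 0 + (∫ x in Ioi 0, rateEnvelope f M B x) / Δ
      ≤ (M * (B + 2) + ∫ T in Ioi 1, f T) / Δ := by
  rw [rateEnvelope_of_le (by linarith), le_div_iff₀ hΔ, add_mul, div_mul_cancel₀ _ hΔ.ne']
  linarith [setIntegral_rateEnvelope_le hpos hanti hint hM hB, mul_le_of_le_one_right hM hΔ1]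

end rateEnvelope

end DecayEnvelope

section SortedTuples

variable {α : Type*} {n : ℕ}

lemma sum_piFinset_comp_perm (s : Finset α) (σ : Equiv.Perm (Fin n)) (F : (Fin n → α) → ℝ) :
    ∑ t ∈ Fintype.piFinset fun _ => s, F (t ∘ σ) = ∑ t ∈ Fintype.piFinset fun _ => s, F t := by
  refine Finset.sum_equiv (σ.symm.arrowCongr (Equiv.refl α)) (fun t => ?_) fun t _ => rfl
  simpa using (Equiv.forall_congr_left σ.symm (p := fun k => t k ∈ s))

lemma sum_piFinset_le_of_monotone [LinearOrder α] (s : Finset α) {F B : (Fin n → α) → ℝ}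
    (hF : ∀ (σ : Equiv.Perm (Fin n)) t, F (t ∘ σ) = F t)
    (hB : ∀ t ∈ Fintype.piFinset fun _ => s, 0 ≤ B t)
    (hle : ∀ t ∈ Fintype.piFinset fun _ => s, Monotone t → F t ≤ B t) :
    ∑ t ∈ Fintype.piFinset fun _ => s, F t
      ≤ n.factorial * ∑ t ∈ Fintype.piFinset fun _ => s, B t := by
  have hmem : ∀ t ∈ Fintype.piFinset fun _ => s, ∀ σ : Equiv.Perm (Fin n),
      t ∘ σ ∈ Fintype.piFinset fun _ => s := fun t ht σ =>
    Fintype.mem_piFinset.2 fun k => Fintype.mem_piFinset.1 ht (σ k)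
  calc ∑ t ∈ Fintype.piFinset fun _ => s, F t
      ≤ ∑ t ∈ Fintype.piFinset fun _ => s, ∑ σ : Equiv.Perm (Fin n), B (t ∘ σ) := by
        refine Finset.sum_le_sum fun t ht => ?_
        rw [← hF (Tuple.sort t)]
        exact (hle _ (hmem t ht _) (Tuple.monotone_sort t)).trans
          (Finset.single_le_sum (f := fun σ : Equiv.Perm (Fin n) => B (t ∘ σ))
            (fun σ _ => hB _ (hmem t ht σ)) (Finset.mem_univ _))
    _ = n.factorial * ∑ t ∈ Fintype.piFinset fun _ => s, B t := by
        rw [Finset.sum_comm]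
        simp [sum_piFinset_comp_perm, Fintype.card_perm]

lemma sum_piFinset_succ (s : Finset α) (F : (Fin (n + 1) → α) → ℝ) :
    ∑ t ∈ Fintype.piFinset fun _ => s, F t
      = ∑ a ∈ s, ∑ t ∈ Fintype.piFinset fun _ => s, F (Matrix.vecCons a t) := by
  rw [← Finset.sum_product']
  refine (Finset.sum_equiv (Fin.consEquiv fun _ => α) (fun p => ?_) fun p _ => rfl).symm
  simp [Fin.forall_fin_succ]

end SortedTuples

section Moments

variable {Ω : Type*} [MeasurableSpace Ω] {P : Measure Ω} {a b : Ω → ℝ}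

lemma eLpNorm_pow_eq_ofReal_integral_pow {n : ℕ} (hn : Even n) (hn0 : n ≠ 0)
    (ha : MemLp a n P) : eLpNorm a n P ^ n = ENNReal.ofReal (∫ ω, a ω ^ n ∂P) := by
  have h := eLpNorm_nnreal_pow_eq_lintegral (μ := P) (f := a) (p := n) (by exact_mod_cast hn0)
  have hpow : ∀ ω, ‖a ω‖ₑ ^ (n : ℝ) = ENNReal.ofReal (a ω ^ n) := fun ω => by
    rw [ENNReal.rpow_natCast, ← ofReal_norm, ← ENNReal.ofReal_pow (norm_nonneg _),
      Real.norm_eq_abs, hn.pow_abs]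
  have hint : Integrable (fun ω => a ω ^ n) P := by
    simpa [Real.norm_eq_abs, hn.pow_abs] using ha.integrable_norm_pow hn0
  rw [ofReal_integral_eq_lintegral_ofReal hint (ae_of_all _ fun ω => hn.pow_nonneg _)]
  simpa [hpow] using h

lemma memLp_two_mul (ha : MemLp a 4 P) (hb : MemLp b 4 P) : MemLp (fun ω => a ω * b ω) 2 P := by
  have : ENNReal.HolderTriple 4 4 2 := ⟨by
    rw [← ENNReal.toReal_eq_toReal_iff' (by simp) (by simp), ENNReal.toReal_add (by simp) (by simp)]
    norm_num⟩
  exact hb.mul ha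

lemma integrable_pow_four (ha : MemLp a 4 P) : Integrable (fun ω => a ω ^ 4) P := by
  simpa [Real.norm_eq_abs, (by decide : Even 4).pow_abs] using
    MemLp.integrable_norm_pow (p := 4) ha (by norm_num)

lemma abs_integral_mul_le (ha : MemLp a 2 P) (hb : MemLp b 2 P) :
    |∫ ω, a ω * b ω ∂P| ≤ (∫ ω, a ω ^ 2 ∂P + ∫ ω, b ω ^ 2 ∂P) / 2 := by
  rw [← integral_add ha.integrable_sq hb.integrable_sq, ← integral_div]
  refine norm_integral_le_of_norm_le (f := fun ω => a ω * b ω)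
    ((ha.integrable_sq.add hb.integrable_sq).div_const 2) (ae_of_all _ fun ω => ?_)
  rw [Real.norm_eq_abs, abs_mul]
  linarith [two_mul_le_add_sq |a ω| |b ω|, sq_abs (a ω), sq_abs (b ω)]

lemma integral_mul_sq_le (ha : MemLp a 4 P) (hb : MemLp b 4 P) :
    ∫ ω, (a ω * b ω) ^ 2 ∂P ≤ (∫ ω, a ω ^ 4 ∂P + ∫ ω, b ω ^ 4 ∂P) / 2 := by
  have h := (le_abs_self _).trans (abs_integral_mul_le (memLp_two_mul ha ha) (memLp_two_mul hb hb))
  calc ∫ ω, (a ω * b ω) ^ 2 ∂P = ∫ ω, a ω * a ω * (b ω * b ω) ∂P := by congr! 2; ring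
    _ ≤ (∫ ω, (a ω * a ω) ^ 2 ∂P + ∫ ω, (b ω * b ω) ^ 2 ∂P) / 2 := h
    _ = _ := by congr! 4 <;> ring

lemma integral_sq_le_one_add [IsProbabilityMeasure P] (ha : MemLp a 4 P) :
    ∫ ω, a ω ^ 2 ∂P ≤ 1 + ∫ ω, a ω ^ 4 ∂P := by
  have h := integral_mul_sq_le ha (memLp_const 1)
  have : 0 ≤ ∫ ω, a ω ^ 4 ∂P := integral_nonneg fun ω => by positivity
  simp only [mul_one, one_pow, integral_const, probReal_univ, smul_eq_mul] at h
  linarith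

lemma abs_covariance_le [IsProbabilityMeasure P] (ha : MemLp a 2 P) (hb : MemLp b 2 P) :
    |cov[a, b; P]| ≤ (∫ ω, a ω ^ 2 ∂P + ∫ ω, b ω ^ 2 ∂P) / 2 := by
  have h := abs_integral_mul_le (ha.sub (memLp_const (∫ ω, a ω ∂P)))
    (hb.sub (memLp_const (∫ ω, b ω ∂P)))
  simp only [Pi.sub_apply] at h
  rw [← variance_eq_integral ha.aemeasurable, ← variance_eq_integral hb.aemeasurable] at h
  have hva := variance_le_expectation_sq ha.aestronglyMeasurable
  have hvb := variance_le_expectation_sq hb.aestronglyMeasurable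
  simp only [Pi.pow_apply] at hva hvb
  exact h.trans (by linarith)

end Moments

section EmpiricalMean

variable {Ω : Type*} [MeasurableSpace Ω] {P : Measure Ω} {g : ℝ → ℝ} {Δ : ℝ} {N : ℕ}
  {Y : ℕ → Ω → ℝ}

lemma IsDecayEnvelope.variance_mean_le [IsProbabilityMeasure P] (hg : IsDecayEnvelope g)
    (hΔ : 0 < Δ) (hY : ∀ n ∈ Finset.Icc 1 N, MemLp (Y n) 2 P)
    (hcov : ∀ a ∈ Finset.Icc 1 N, ∀ b ∈ Finset.Icc 1 N,
      cov[Y a, Y b; P] ≤ g (|(a : ℝ) - b| * Δ)) :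
    Var[fun ω => 1 / (N : ℝ) * ∑ n ∈ Finset.Icc 1 N, Y n ω; P]
      ≤ 2 * (g 0 + (∫ x in Ioi 0, g x) / Δ) / N := by
  rw [variance_const_mul, variance_fun_sum' hY]
  calc (1 / (N : ℝ)) ^ 2 * ∑ a ∈ Finset.Icc 1 N, ∑ b ∈ Finset.Icc 1 N, cov[Y a, Y b; P]
      ≤ (1 / (N : ℝ)) ^ 2 * (N * (2 * (g 0 + (∫ x in Ioi 0, g x) / Δ))) := by
        gcongr
        exact (Finset.sum_le_sum fun a ha => Finset.sum_le_sum fun b hb => hcov a ha b hb).trans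
          (hg.sum_sum_le hΔ N)
    _ = _ := by
        rcases eq_or_ne N 0 with rfl | hN
        · simp
        · field_simp

lemma integrable_prod_four (hY : ∀ n ∈ Finset.Icc 1 N, MemLp (Y n) 4 P) {t : Fin 4 → ℕ}
    (ht : t ∈ Fintype.piFinset fun _ => Finset.Icc 1 N) :
    Integrable (fun ω => ∏ k, Y (t k) ω) P := by
  have hmem : ∀ k, MemLp (Y (t k)) 4 P := fun k => hY _ (Fintype.mem_piFinset.1 ht k)
  refine ((memLp_two_mul (hmem 0) (hmem 1)).integrable_mul
    (memLp_two_mul (hmem 2) (hmem 3))).congr (ae_of_all _ fun ω => ?_)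
  simp [Fin.prod_univ_four, mul_assoc]

lemma IsDecayEnvelope.sum_piFinset_four_le (hg : IsDecayEnvelope g) (hΔ : 0 < Δ) (N : ℕ) :
    ∑ t ∈ Fintype.piFinset fun _ : Fin 4 => Finset.Icc 1 N,
        (g (|(t 0 : ℝ) - t 1| * Δ) + g (|(t 1 : ℝ) - t 2| * Δ))
      ≤ 4 * (g 0 + (∫ x in Ioi 0, g x) / Δ) * N ^ 3 := by
  have h := hg.sum_sum_le hΔ N
  calc _ = 2 * N ^ 2 * ∑ a ∈ Finset.Icc 1 N, ∑ b ∈ Finset.Icc 1 N, g (|(a : ℝ) - b| * Δ) := by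
        simp only [Fin.isValue, Finset.sum_add_distrib, sum_piFinset_succ, Matrix.cons_val_zero,
          Matrix.cons_val_one, Finset.sum_const, Fintype.card_piFinset, Nat.card_Icc,
          add_tsub_cancel_right, Finset.prod_const, Finset.card_univ, Fintype.card_fin,
          nsmul_eq_mul, Nat.cast_pow, ← Finset.mul_sum, Matrix.cons_val, Finset.univ_unique,
          Fin.default_eq_zero, Finset.card_singleton, pow_one]
        ring
    _ ≤ 2 * N ^ 2 * (N * (2 * (g 0 + (∫ x in Ioi 0, g x) / Δ))) := by gcongr
    _ = _ := by ring

lemma IsDecayEnvelope.integral_mean_pow_four_le (hg : IsDecayEnvelope g) (hΔ : 0 < Δ)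
    (hY : ∀ n ∈ Finset.Icc 1 N, MemLp (Y n) 4 P)
    (hprod : ∀ t ∈ Fintype.piFinset fun _ : Fin 4 => Finset.Icc 1 N, Monotone t →
      ∫ ω, ∏ k, Y (t k) ω ∂P ≤ g (|(t 0 : ℝ) - t 1| * Δ) + g (|(t 1 : ℝ) - t 2| * Δ)) :
    ∫ ω, (1 / (N : ℝ) * ∑ n ∈ Finset.Icc 1 N, Y n ω) ^ 4 ∂P
      ≤ 96 * (g 0 + (∫ x in Ioi 0, g x) / Δ) / N := by
  have hperm : ∀ (σ : Equiv.Perm (Fin 4)) (t : Fin 4 → ℕ),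
      ∫ ω, ∏ k, Y ((t ∘ σ) k) ω ∂P = ∫ ω, ∏ k, Y (t k) ω ∂P := fun σ t => by
    congr! 2 with ω
    exact Equiv.prod_comp σ fun k => Y (t k) ω
  have hsum := sum_piFinset_le_of_monotone (Finset.Icc 1 N) hperm (fun t _ => add_nonneg
    (hg.nonneg _ (by positivity)) (hg.nonneg _ (by positivity))) hprod
  simp only [mul_pow, Finset.sum_pow', integral_const_mul]
  rw [integral_finsetSum _ fun t ht => integrable_prod_four hY ht]
  calc (1 / (N : ℝ)) ^ 4 * ∑ t ∈ Fintype.piFinset fun _ : Fin 4 => Finset.Icc 1 N,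
        ∫ ω, ∏ k, Y (t k) ω ∂P
      ≤ (1 / (N : ℝ)) ^ 4 * (24 * (4 * (g 0 + (∫ x in Ioi 0, g x) / Δ) * N ^ 3)) := by
        gcongr
        exact hsum.trans (mul_le_mul (by norm_num [Nat.factorial]) (hg.sum_piFinset_four_le hΔ N)
          (Finset.sum_nonneg fun t _ => add_nonneg (hg.nonneg _ (by positivity))
            (hg.nonneg _ (by positivity))) (by norm_num))
    _ = _ := by
        rcases eq_or_ne N 0 with rfl | hN
        · simp
        · field_simp
          ring

end EmpiricalMean

section LagMonomials

variable {Ω : Type*} {r : ℕ} {X : ℝ → Ω → Fin r → ℝ}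

lemma lagMonomials_mono {U V : Set ℝ} (h : U ⊆ V) : lagMonomials X U ⊆ lagMonomials X V := by
  rintro G (⟨s, hs, hG⟩ | ⟨s, hs, t, ht, hG⟩)
  exacts [Or.inl ⟨s, h hs, hG⟩, Or.inr ⟨s, h hs, t, h ht, hG⟩]

lemma apply_mem_lagMonomials {U : Set ℝ} {s : ℝ} (hs : s ∈ U) (i : Fin r) :
    (fun ω => X s ω i) ∈ lagMonomials X U :=
  Or.inl ⟨s, hs, i, rfl⟩

lemma mul_mem_lagMonomials {U : Set ℝ} {s t : ℝ} (hs : s ∈ U) (ht : t ∈ U) (i j : Fin r) :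
    (fun ω => X s ω i * X t ω j) ∈ lagMonomials X U :=
  Or.inr ⟨s, hs, t, ht, i, j, rfl⟩

lemma exists_measurable_eq_of_mem_lagMonomials {U : Set ℝ} {G : Ω → ℝ}
    (hG : G ∈ lagMonomials X U) :
    ∃ φ : (U × Fin r → ℝ) → ℝ, Measurable φ ∧ G = φ ∘ fun ω p => X p.1 ω p.2 := by
  rcases hG with ⟨s, hs, i, rfl⟩ | ⟨s, hs, t, ht, i, j, rfl⟩
  · exact ⟨fun x => x (⟨s, hs⟩, i), by fun_prop, rfl⟩
  · exact ⟨fun x => x (⟨s, hs⟩, i) * x (⟨t, ht⟩, j), by fun_prop, rfl⟩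

end LagMonomials

section AdmissibleProcess

variable {Ω : Type*} [MeasurableSpace Ω] {P : Measure Ω} {r : ℕ}
  {X : ℝ → Ω → Fin r → ℝ} {f : ℝ → ℝ}

namespace IsAdmissibleProcess

lemma memLp_apply (hX : IsAdmissibleProcess P X f) {t : ℝ} (ht : 0 ≤ t) (i : Fin r) :
    MemLp (fun ω => X t ω i) 4 P :=
  (hX.memLp t ht).eval i

lemma integral_comp_add (hX : IsAdmissibleProcess P X f) {n : ℕ} {t : Fin n → ℝ}
    (ht : ∀ k, 0 ≤ t k) {h : ℝ} (hh : 0 ≤ h) {φ : (Fin n → Fin r → ℝ) → ℝ} (hφ : Continuous φ) :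
    ∫ ω, φ (fun k => X (t k + h) ω) ∂P = ∫ ω, φ (fun k => X (t k) ω) ∂P := by
  have hmeas : ∀ s : Fin n → ℝ, (∀ k, 0 ≤ s k) → AEMeasurable (fun ω k => X (s k) ω) P :=
    fun s hs => aemeasurable_pi_iff.2 fun k =>
      (hX.memLp _ (hs k)).aestronglyMeasurable.aemeasurable
  rw [← integral_map (φ := fun ω k => X (t k + h) ω) (f := φ)
    (hmeas _ fun k => add_nonneg (ht k) hh) hφ.aestronglyMeasurable,
    ← integral_map (φ := fun ω k => X (t k) ω) (f := φ) (hmeas _ ht) hφ.aestronglyMeasurable,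
    hX.stationary n t h ht hh]

lemma integral_apply (hX : IsAdmissibleProcess P X f) {t : ℝ} (ht : 0 ≤ t) (i : Fin r) :
    ∫ ω, X t ω i ∂P = ∫ ω, X 0 ω i ∂P := by
  simpa using hX.integral_comp_add (t := fun _ : Fin 1 => 0) (fun _ => le_rfl) ht
    (φ := fun x => x 0 i) (by fun_prop)

lemma integral_mul_apply (hX : IsAdmissibleProcess P X f) {t u : ℝ} (ht : 0 ≤ t) (hu : 0 ≤ u)
    (i j : Fin r) : ∫ ω, X t ω i * X (t + u) ω j ∂P = ∫ ω, X 0 ω i * X u ω j ∂P := by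
  simpa [add_comm] using hX.integral_comp_add (t := ![0, u])
    (fun k => by fin_cases k <;> simp [hu]) ht (φ := fun x => x 0 i * x 1 j) (by fun_prop)

lemma integral_pow_four_le (hX : IsAdmissibleProcess P X f) {ν : ℝ≥0}
    (hν : eLpNorm (X 0) 4 P ≤ ν) {t : ℝ} (ht : 0 ≤ t) (i : Fin r) :
    ∫ ω, X t ω i ^ 4 ∂P ≤ ν ^ 4 := by
  have hshift : ∫ ω, X t ω i ^ 4 ∂P = ∫ ω, X 0 ω i ^ 4 ∂P := by
    simpa using hX.integral_comp_add (t := fun _ : Fin 1 => 0) (fun _ => le_rfl) ht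
      (φ := fun x => x 0 i ^ 4) (by fun_prop)
  have hnorm : eLpNorm (fun ω => X 0 ω i) 4 P ≤ ν :=
    (eLpNorm_mono fun ω => norm_le_pi_norm (X 0 ω) i).trans hν
  have hpow := eLpNorm_pow_eq_ofReal_integral_pow (n := 4) (by decide) (by norm_num)
    (hX.memLp_apply le_rfl i)
  rw [hshift, ← ENNReal.ofReal_le_ofReal_iff (by positivity), ← hpow,
    ENNReal.ofReal_pow ν.coe_nonneg, ENNReal.ofReal_coe_nnreal]
  exact pow_le_pow_left' hnorm 4

end IsAdmissibleProcess

variable [IsProbabilityMeasure P]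

lemma memLp_two_of_mem_lagMonomials {U : Set ℝ} (hX : ∀ t ∈ U, MemLp (X t) 4 P) {G : Ω → ℝ}
    (hG : G ∈ lagMonomials X U) : MemLp G 2 P := by
  rcases hG with ⟨s, hs, i, rfl⟩ | ⟨s, hs, t, ht, i, j, rfl⟩
  · exact ((hX s hs).eval i).mono_exponent (by norm_num)
  · exact memLp_two_mul ((hX s hs).eval i) ((hX t ht).eval j)

namespace IsAdmissibleProcess

lemma memLp_lagMonomial (hX : IsAdmissibleProcess P X f) {G : Ω → ℝ}
    (hG : G ∈ lagMonomials X (Ici 0)) : MemLp G 2 P :=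
  memLp_two_of_mem_lagMonomials hX.memLp hG

lemma integral_lagMonomial_sq_le (hX : IsAdmissibleProcess P X f) {ν : ℝ≥0}
    (hν : eLpNorm (X 0) 4 P ≤ ν) {G : Ω → ℝ} (hG : G ∈ lagMonomials X (Ici 0)) :
    ∫ ω, G ω ^ 2 ∂P ≤ 1 + ν ^ 4 := by
  rcases hG with ⟨s, hs, i, rfl⟩ | ⟨s, hs, t, ht, i, j, rfl⟩
  · exact (integral_sq_le_one_add (hX.memLp_apply hs i)).trans
      (by gcongr; exact hX.integral_pow_four_le hν hs i)
  · have h := integral_mul_sq_le (hX.memLp_apply hs i) (hX.memLp_apply ht j)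
    linarith [hX.integral_pow_four_le hν hs i, hX.integral_pow_four_le hν ht j]

lemma abs_covariance_lagMonomial_le (hX : IsAdmissibleProcess P X f) {ν : ℝ≥0}
    (hν : eLpNorm (X 0) 4 P ≤ ν) {G H : Ω → ℝ} (hG : G ∈ lagMonomials X (Ici 0))
    (hH : H ∈ lagMonomials X (Ici 0)) : |cov[G, H; P]| ≤ 1 + ν ^ 4 := by
  linarith [abs_covariance_le (hX.memLp_lagMonomial hG) (hX.memLp_lagMonomial hH),
    hX.integral_lagMonomial_sq_le hν hG, hX.integral_lagMonomial_sq_le hν hH]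

lemma abs_covariance_lagMonomial_Icc_le (hX : IsAdmissibleProcess P X f) {a b c d : ℝ}
    (ha : 0 ≤ a) (hab : a ≤ b) (hbc : b < c) (hcd : c ≤ d) {G H : Ω → ℝ}
    (hG : G ∈ lagMonomials X (Icc a b)) (hH : H ∈ lagMonomials X (Icc c d)) :
    |cov[G, H; P]| ≤ f (c - b) := by
  have hU : Icc a b ⊆ Ici 0 := fun x hx => ha.trans hx.1
  have hV : Icc c d ⊆ Ici 0 := fun x hx => ha.trans (hab.trans (hbc.le.trans hx.1))
  rw [covariance_eq_sub (hX.memLp_lagMonomial (lagMonomials_mono hU hG))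
    (hX.memLp_lagMonomial (lagMonomials_mono hV hH))]
  refine hX.decorrelation.decorrelation (Icc a b) (Icc c d) (c - b) hU hV ordConnected_Icc
    ordConnected_Icc ⟨a, le_rfl, hab⟩ ⟨c, le_rfl, hcd⟩ (sub_pos.2 hbc) ⟨?_, ?_⟩ G hG H hH
  · rintro _ ⟨u, hu, v, hv, rfl⟩
    exact sub_le_sub hv.1 hu.2
  · exact fun x hx => hx ⟨b, ⟨hab, le_rfl⟩, c, ⟨le_rfl, hcd⟩, rfl⟩

end IsAdmissibleProcess

end AdmissibleProcess

section Centring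

variable {Ω : Type*} [MeasurableSpace Ω] {P : Measure Ω} {r : ℕ}
  {X : ℝ → Ω → Fin r → ℝ} {f : ℝ → ℝ} {m : Fin r → ℝ} {κ : ℝ}

lemma IsStrictlyStationary.sub_const (hX : IsStrictlyStationary P X)
    (hmeas : ∀ t, 0 ≤ t → AEMeasurable (X t) P) (m : Fin r → ℝ) :
    IsStrictlyStationary P (fun t ω => X t ω - m) := by
  intro n t h ht hh
  have hmap : ∀ s : Fin n → ℝ, (∀ k, 0 ≤ s k) → P.map (fun ω k => X (s k) ω - m)
      = (P.map fun ω k => X (s k) ω).map fun x k => x k - m := fun s hs => by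
    rw [AEMeasurable.map_map_of_aemeasurable (Measurable.aemeasurable (by fun_prop))
      (aemeasurable_pi_iff.2 fun k => hmeas _ (hs k))]
    rfl
  rw [hmap _ fun k => add_nonneg (ht k) hh, hmap _ ht, hX n t h ht hh]

variable [IsProbabilityMeasure P]

lemma covariance_sub_mul_sub {G a b : Ω → ℝ} (hG : MemLp G 2 P) (ha : MemLp a 4 P)
    (hb : MemLp b 4 P) (p q : ℝ) :
    cov[G, fun ω => (a ω - p) * (b ω - q); P]
      = cov[G, fun ω => a ω * b ω; P] - (q * cov[G, a; P] + p * cov[G, b; P]) := by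
  have hexpand : (fun ω => (a ω - p) * (b ω - q))
      = fun ω => a ω * b ω - (q * a ω + p * b ω) + p * q := by
    ext ω
    ring
  have ha' : MemLp (fun ω => q * a ω) 2 P := (ha.mono_exponent (by norm_num)).const_mul q
  have hb' : MemLp (fun ω => p * b ω) 2 P := (hb.mono_exponent (by norm_num)).const_mul p
  have hprod := memLp_two_mul ha hb
  have hadd : cov[G, fun ω => q * a ω + p * b ω; P] = q * cov[G, a; P] + p * cov[G, b; P] :=
    (covariance_add_right hG ha' hb').trans (by simp only [covariance_const_mul_right])
  have hlinear : MemLp (fun ω => q * a ω + p * b ω) 2 P := ha'.add hb'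
  have hdiff : Integrable (fun ω => a ω * b ω - (q * a ω + p * b ω)) P :=
    (hprod.sub hlinear).integrable one_le_two
  rw [hexpand, covariance_add_const_right hdiff, covariance_fun_sub_right hG hprod hlinear,
    hadd]

lemma abs_covariance_sub_const_le {V : Set ℝ} (hX : ∀ t ∈ V, MemLp (X t) 4 P)
    (hm : ∀ i, |m i| ≤ κ) {G : Ω → ℝ} (hG : MemLp G 2 P) {δ : ℝ}
    (hcov : ∀ H ∈ lagMonomials X V, |cov[G, H; P]| ≤ δ) {H : Ω → ℝ}
    (hH : H ∈ lagMonomials (fun t ω => X t ω - m) V) :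
    |cov[G, H; P]| ≤ (1 + 2 * κ) * δ := by
  have hδ : ∀ {s}, s ∈ V → ∀ i, |cov[G, fun ω => X s ω i; P]| ≤ δ := fun hs i =>
    hcov _ (apply_mem_lagMonomials hs i)
  have hLp : ∀ {s}, s ∈ V → ∀ i, MemLp (fun ω => X s ω i) 2 P := fun hs i =>
    ((hX _ hs).eval i).mono_exponent (by norm_num)
  rcases hH with ⟨s, hs, i, rfl⟩ | ⟨s, hs, t, ht, i, j, rfl⟩
  · have hκ := (abs_nonneg _).trans (hm i)
    have hδ0 := (abs_nonneg _).trans (hδ hs i)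
    simp only [Pi.sub_apply]
    rw [covariance_sub_const_right ((hLp hs i).integrable (by norm_num))]
    nlinarith [hδ hs i]
  · have hlin := covariance_sub_mul_sub hG ((hX s hs).eval i) ((hX t ht).eval j) (m i) (m j)
    have hsmall : ∀ k {s}, s ∈ V → ∀ l, |m k * cov[G, fun ω => X s ω l; P]| ≤ κ * δ :=
      fun k s hs l => by
        rw [abs_mul]
        exact mul_le_mul (hm k) (hδ hs l) (abs_nonneg _) ((abs_nonneg _).trans (hm k))
    simp only [Pi.sub_apply]
    rw [hlin]
    linarith [abs_sub (cov[G, fun ω => X s ω i * X t ω j; P])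
      (m j * cov[G, fun ω => X s ω i; P] + m i * cov[G, fun ω => X t ω j; P]),
      abs_add_le (m j * cov[G, fun ω => X s ω i; P]) (m i * cov[G, fun ω => X t ω j; P]),
      hcov _ (mul_mem_lagMonomials hs ht i j), hsmall j hs i, hsmall i ht j]

lemma IsAdmissibleProcess.laggedCov_sub_const (hX : IsAdmissibleProcess P X f) (m : Fin r → ℝ)
    {u : ℝ} (hu : 0 ≤ u) : laggedCov P (fun t ω => X t ω - m) u = laggedCov P X u := by
  have hLp : ∀ {t}, 0 ≤ t → ∀ k, MemLp (fun ω => X t ω k) 2 P := fun ht k =>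
    (hX.memLp_apply ht k).mono_exponent (by norm_num)
  have hLp' : ∀ {t}, 0 ≤ t → ∀ k, MemLp (fun ω => X t ω k - m k) 2 P := fun ht k =>
    (hLp ht k).sub (memLp_const _)
  have hint : ∀ {t}, 0 ≤ t → ∀ k, Integrable (fun ω => X t ω k) P := fun ht k =>
    (hLp ht k).integrable (by norm_num)
  have hmean : ∀ {t}, 0 ≤ t → ∀ k, ∫ ω, (X t ω k - m k) ∂P = ∫ ω, X 0 ω k ∂P - m k :=
    fun ht k => by simp [integral_sub (hint ht k) (integrable_const _), hX.integral_apply ht]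
  ext i j
  have hcov := covariance_eq_sub (hLp le_rfl i) (hLp hu j)
  have hcov' := covariance_eq_sub (hLp' le_rfl i) (hLp' hu j)
  rw [covariance_sub_const_left (hint le_rfl i), covariance_sub_const_right (hint hu j), hcov]
    at hcov'
  simpa [laggedCov, hmean hu, hmean le_rfl, hX.integral_apply hu] using hcov'.symm

lemma HasIntegrableDecorrelationRate.sub_const (hf : HasIntegrableDecorrelationRate P X f)
    (hX : ∀ t, 0 ≤ t → MemLp (X t) 4 P) (hκ : 0 ≤ κ) (hm : ∀ i, |m i| ≤ κ) :
    HasIntegrableDecorrelationRate P (fun t ω => X t ω - m) fun T => (1 + 2 * κ) ^ 2 * f T where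
  pos T hT := mul_pos (by positivity) (hf.pos T hT)
  antitone x hx y hy hxy := mul_le_mul_of_nonneg_left (hf.antitone hx hy hxy) (by positivity)
  continuous := hf.continuous.const_mul _
  integrable := hf.integrable.const_mul _
  decorrelation U V T hU hV hUc hVc hUne hVne hT hgap G hG H hH := by
    have hX' : ∀ t, 0 ≤ t → MemLp (fun ω => X t ω - m) 4 P := fun t ht =>
      (hX t ht).sub (memLp_const m)
    have hLp : ∀ {W : Set ℝ}, W ⊆ Ici 0 → ∀ F ∈ lagMonomials X W, MemLp F 2 P :=
      fun hW F hF => memLp_two_of_mem_lagMonomials (fun t ht => hX t (hW ht)) hF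
    have hG' := memLp_two_of_mem_lagMonomials (fun t ht => hX' t (hU ht)) hG
    have hH' := memLp_two_of_mem_lagMonomials (fun t ht => hX' t (hV ht)) hH
    have hcov : ∀ F ∈ lagMonomials X U, |cov[F, H; P]| ≤ (1 + 2 * κ) * f T := fun F hF => by
      refine abs_covariance_sub_const_le (fun t ht => hX t (hV ht)) hm (hLp hU F hF)
        (fun K hK => ?_) hH
      rw [covariance_eq_sub (hLp hU F hF) (hLp hV K hK)]
      exact hf.decorrelation U V T hU hV hUc hVc hUne hVne hT hgap F hF K hK
    have h := abs_covariance_sub_const_le (fun t ht => hX t (hU ht)) hm hH'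
      (fun F hF => by rw [covariance_comm]; exact hcov F hF) hG
    rw [covariance_comm, covariance_eq_sub hG' hH'] at h
    exact h.trans_eq (by ring)

lemma IsAdmissibleProcess.sub_const (hX : IsAdmissibleProcess P X f) (hκ : 0 ≤ κ)
    (hm : ∀ i, |m i| ≤ κ) :
    IsAdmissibleProcess P (fun t ω => X t ω - m) fun T => (1 + 2 * κ) ^ 2 * f T where
  stationary := hX.stationary.sub_const
    (fun t ht => (hX.memLp t ht).aestronglyMeasurable.aemeasurable) m
  memLp t ht := (hX.memLp t ht).sub (memLp_const m)
  locallyLipschitz i j x hx := by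
    obtain ⟨K, s, hs, hK⟩ := hX.locallyLipschitz i j hx
    refine ⟨K, s ∩ Ici 0, inter_mem hs self_mem_nhdsWithin, fun u hu v hv => ?_⟩
    simp only [hX.laggedCov_sub_const m hu.2, hX.laggedCov_sub_const m hv.2]
    exact hK hu.1 hv.1
  decorrelation := hX.decorrelation.sub_const hX.memLp hκ hm

end Centring

section EmpiricalCovariance

lemma round_div_nonneg {Δ u : ℝ} (hΔ : 0 < Δ) (hu : 0 ≤ u) : 0 ≤ round (u / Δ) := by
  rw [round_eq]
  exact Int.floor_nonneg.2 (by positivity)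

lemma abs_round_div_mul_sub_le {Δ : ℝ} (hΔ : 0 < Δ) (u : ℝ) :
    |(round (u / Δ) : ℝ) * Δ - u| ≤ Δ / 2 := by
  calc |(round (u / Δ) : ℝ) * Δ - u| = |u / Δ - round (u / Δ)| * Δ := by
        rw [abs_sub_comm, ← abs_of_pos hΔ, ← abs_mul, abs_of_pos hΔ, sub_mul,
          div_mul_cancel₀ _ hΔ.ne']
    _ ≤ 1 / 2 * Δ := by gcongr; exact abs_sub_round _
    _ = Δ / 2 := by ring

variable {Ω : Type*} {r : ℕ} {X : ℝ → Ω → Fin r → ℝ} {N : ℕ} {Δ u : ℝ} {κ : ℤ}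

lemma shiftedMean_apply (X : ℝ → Ω → Fin r → ℝ) (N : ℕ) (Δ : ℝ) (κ : ℤ) (ω : Ω) (j : Fin r) :
    shiftedMean X N Δ κ ω j
      = 1 / (N : ℝ) * ∑ n ∈ Finset.Icc 1 N, X (((n : ℝ) + κ) * Δ) ω j := by
  simp [shiftedMean]

lemma empiricalCov_apply (X : ℝ → Ω → Fin r → ℝ) (N : ℕ) (Δ u : ℝ) (ω : Ω) (i j : Fin r) :
    empiricalCov X N Δ u ω i j
      = 1 / (N : ℝ) * ∑ n ∈ Finset.Icc 1 N, X (n * Δ) ω i * X ((n + round (u / Δ)) * Δ) ω j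
        - shiftedMean X N Δ 0 ω i * shiftedMean X N Δ (round (u / Δ)) ω j := by
  simp [empiricalCov, Matrix.sum_apply, Matrix.vecMulVec_apply]

lemma shiftedMean_sub_const (hN : N ≠ 0) (m : Fin r → ℝ) (ω : Ω) :
    shiftedMean (fun t ω => X t ω - m) N Δ κ ω = shiftedMean X N Δ κ ω - m := by
  have hN' : 1 / (N : ℝ) * N = 1 := one_div_mul_cancel (by exact_mod_cast hN)
  ext j
  simp only [shiftedMean_apply, Pi.sub_apply, Finset.sum_sub_distrib, Finset.sum_const,
    Nat.card_Icc, nsmul_eq_mul, add_tsub_cancel_right]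
  linear_combination -m j * hN'

lemma empiricalCov_sub_const (hN : N ≠ 0) (m : Fin r → ℝ) (ω : Ω) :
    empiricalCov (fun t ω => X t ω - m) N Δ u ω = empiricalCov X N Δ u ω := by
  have hN' : 1 / (N : ℝ) * N = 1 := one_div_mul_cancel (by exact_mod_cast hN)
  have hexpand : ∀ x y i j, (x - m i) * (y - m j) = x * y - m j * x - m i * y + m i * m j :=
    fun x y i j => by ring
  ext i j
  rw [empiricalCov_apply, empiricalCov_apply, shiftedMean_sub_const hN, shiftedMean_sub_const hN]
  simp only [Pi.sub_apply, hexpand, Finset.sum_add_distrib, Finset.sum_sub_distrib,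
    ← Finset.mul_sum, Finset.sum_const, Nat.card_Icc, nsmul_eq_mul, add_tsub_cancel_right,
    shiftedMean_apply, Int.cast_zero, add_zero]
  linear_combination m i * m j * hN'

variable [MeasurableSpace Ω] {P : Measure Ω}

lemma IsAdmissibleProcess.memLp_shiftedMean {f : ℝ → ℝ} (hX : IsAdmissibleProcess P X f)
    (hΔ : 0 < Δ) (N : ℕ) (hκ : 0 ≤ κ) (j : Fin r) :
    MemLp (fun ω => shiftedMean X N Δ κ ω j) 4 P := by
  have : (0 : ℝ) ≤ κ := by exact_mod_cast hκ
  simp only [shiftedMean_apply]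
  exact (memLp_finsetSum _ fun n _ => hX.memLp_apply (by positivity) j).const_mul _

lemma IsAdmissibleProcess.memLp_empiricalCov {f : ℝ → ℝ}
    (hX : IsAdmissibleProcess P X f) (hΔ : 0 < Δ) (N : ℕ) (hu : 0 ≤ u) (i j : Fin r) :
    MemLp (fun ω => empiricalCov X N Δ u ω i j) 2 P := by
  have hκ := round_div_nonneg hΔ hu
  have : (0 : ℝ) ≤ round (u / Δ) := by exact_mod_cast hκ
  simp only [empiricalCov_apply]
  exact ((memLp_finsetSum _ fun n _ => memLp_two_mul (hX.memLp_apply (by positivity) i)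
    (hX.memLp_apply (by positivity) j)).const_mul _).sub
    (memLp_two_mul (hX.memLp_shiftedMean hΔ N le_rfl i) (hX.memLp_shiftedMean hΔ N hκ j))

lemma eLpNorm_apply_le_covError (X : ℝ → Ω → Fin r → ℝ) (N : ℕ) (Δ u : ℝ) (i j : Fin r) :
    eLpNorm (fun ω => empiricalCov X N Δ u ω i j - laggedCov P X u i j) 2 P
      ≤ covError P X N Δ u :=
  eLpNorm_mono fun ω =>
    (norm_le_pi_norm (Matrix.of.symm (empiricalCov X N Δ u ω - laggedCov P X u) i) j).trans
      (norm_le_pi_norm (Matrix.of.symm (empiricalCov X N Δ u ω - laggedCov P X u)) i)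

lemma IsAdmissibleProcess.covError_sub_const [IsProbabilityMeasure P] {f : ℝ → ℝ}
    (hX : IsAdmissibleProcess P X f) (hN : N ≠ 0) (hu : 0 ≤ u) (m : Fin r → ℝ) :
    covError P (fun t ω => X t ω - m) N Δ u = covError P X N Δ u := by
  simp only [covError, empiricalCov_sub_const hN, hX.laggedCov_sub_const m hu]

end EmpiricalCovariance

section UpperBound

variable {Ω : Type*} [MeasurableSpace Ω] {P : Measure Ω} {r : ℕ} {X : ℝ → Ω → Fin r → ℝ}

lemma covError_le_of_forall_eLpNorm_le {N : ℕ} {Δ u : ℝ} {s : ℝ≥0∞}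
    (hmeas : ∀ i j, AEStronglyMeasurable (fun ω => empiricalCov X N Δ u ω i j) P)
    (hs : ∀ i j, eLpNorm (fun ω => empiricalCov X N Δ u ω i j - laggedCov P X u i j) 2 P ≤ s) :
    covError P X N Δ u ≤ r ^ 2 * s := by
  set E : Fin r × Fin r → Ω → ℝ := fun p ω =>
    ‖empiricalCov X N Δ u ω p.1 p.2 - laggedCov P X u p.1 p.2‖
  have hnonneg : ∀ p ω, 0 ≤ E p ω := fun p ω => norm_nonneg _
  calc covError P X N Δ u
      ≤ eLpNorm (∑ p, E p) 2 P := by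
        refine eLpNorm_mono_real fun ω => ?_
        have hsum : 0 ≤ ∑ p, E p ω := Finset.sum_nonneg fun p _ => hnonneg p ω
        rw [Finset.sum_apply]
        exact (pi_norm_le_iff_of_nonneg hsum).2 fun i => (pi_norm_le_iff_of_nonneg hsum).2 fun j =>
          Finset.single_le_sum (f := fun p => E p ω) (fun p _ => hnonneg p ω)
            (Finset.mem_univ (i, j))
    _ ≤ ∑ p, eLpNorm (E p) 2 P :=
        eLpNorm_sum_le (fun p _ => ((hmeas p.1 p.2).sub aestronglyMeasurable_const).norm)
          (by norm_num)
    _ ≤ ∑ _p : Fin r × Fin r, s :=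
        Finset.sum_le_sum fun p _ => (eLpNorm_norm _).trans_le (hs p.1 p.2)
    _ = r ^ 2 * s := by simp [sq]

variable [IsProbabilityMeasure P] {f : ℝ → ℝ} {ν : ℝ≥0}

namespace IsAdmissibleProcess

lemma abs_covariance_lagged_mul_le (hX : IsAdmissibleProcess P X f) (hν : eLpNorm (X 0) 4 P ≤ ν)
    {B s t w : ℝ} (hs : 0 ≤ s) (ht : 0 ≤ t) (hw : 0 ≤ w) (hwB : w ≤ B) (i j : Fin r) :
    |cov[fun ω => X s ω i * X (s + w) ω j, fun ω => X t ω i * X (t + w) ω j; P]|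
      ≤ rateEnvelope f (1 + ν ^ 4) B |s - t| := by
  wlog hst : s ≤ t generalizing s t
  · rw [covariance_comm, abs_sub_comm]
    exact this ht hs (le_of_not_ge hst)
  have hmem : ∀ {x}, (fun ω => X x ω i * X (x + w) ω j) ∈ lagMonomials X (Icc x (x + w)) :=
    mul_mem_lagMonomials (left_mem_Icc.2 (by linarith)) (right_mem_Icc.2 (by linarith)) i j
  have htrivial := hX.abs_covariance_lagMonomial_le hν
    (lagMonomials_mono (fun x hx => hs.trans hx.1) (hmem (x := s)))
    (lagMonomials_mono (fun x hx => ht.trans hx.1) (hmem (x := t)))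
  rw [abs_of_nonpos (by linarith : s - t ≤ 0), neg_sub]
  rcases le_or_gt (t - s) (B + 1) with hlag | hlag
  · rwa [rateEnvelope_of_le hlag]
  · rw [rateEnvelope_of_lt hlag]
    refine le_min htrivial ((hX.abs_covariance_lagMonomial_Icc_le hs (by linarith) (by linarith)
      (by linarith) hmem hmem).trans (hX.decorrelation.antitone ?_ ?_ (by linarith)))
    all_goals exact mem_Ioi.2 (by linarith)

lemma abs_integral_mul_mul_le (hX : IsAdmissibleProcess P X f) (hν : eLpNorm (X 0) 4 P ≤ ν)
    (hmean : ∀ i, ∫ ω, X 0 ω i ∂P = 0) {s₀ s₁ s₂ s₃ : ℝ} (h₀ : 0 ≤ s₀) (h₀₁ : s₀ < s₁)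
    (h₁₂ : s₁ < s₂) (h₂₃ : s₂ ≤ s₃) (i : Fin r) :
    |∫ ω, X s₀ ω i * X s₁ ω i * (X s₂ ω i * X s₃ ω i) ∂P|
      ≤ f (s₂ - s₁) + f (s₁ - s₀) * (1 + ν ^ 4) := by
  have hG : (fun ω => X s₀ ω i * X s₁ ω i) ∈ lagMonomials X (Icc s₀ s₁) :=
    mul_mem_lagMonomials (left_mem_Icc.2 h₀₁.le) (right_mem_Icc.2 h₀₁.le) i i
  have hH : (fun ω => X s₂ ω i * X s₃ ω i) ∈ lagMonomials X (Icc s₂ s₃) :=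
    mul_mem_lagMonomials (left_mem_Icc.2 h₂₃) (right_mem_Icc.2 h₂₃) i i
  have hcov := hX.abs_covariance_lagMonomial_Icc_le h₀ h₀₁.le h₁₂ h₂₃ hG hH
  have hLp : ∀ {t}, 0 ≤ t → MemLp (fun ω => X t ω i) 2 P := fun ht =>
    (hX.memLp_apply ht i).mono_exponent (by norm_num)
  have hfirst : |∫ ω, X s₀ ω i * X s₁ ω i ∂P| ≤ f (s₁ - s₀) := by
    have h := hX.abs_covariance_lagMonomial_Icc_le h₀ le_rfl h₀₁ le_rfl
      (apply_mem_lagMonomials (left_mem_Icc.2 le_rfl) i)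
      (apply_mem_lagMonomials (left_mem_Icc.2 le_rfl) i)
    rw [covariance_eq_sub (hLp h₀) (hLp (by linarith)), hX.integral_apply h₀, hmean, zero_mul,
      sub_zero] at h
    exact h
  have hlast : |∫ ω, X s₂ ω i * X s₃ ω i ∂P| ≤ 1 + ν ^ 4 := by
    have h := abs_integral_mul_le (hLp (by linarith : 0 ≤ s₂)) (hLp (by linarith : 0 ≤ s₃))
    have hsq := fun t ht => hX.integral_lagMonomial_sq_le hν
      (apply_mem_lagMonomials (X := X) (U := Ici 0) (s := t) ht i)
    linarith [hsq s₂ (mem_Ici.2 (by linarith)), hsq s₃ (mem_Ici.2 (by linarith))]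
  rw [covariance_eq_sub (hX.memLp_lagMonomial (lagMonomials_mono (fun x hx => h₀.trans hx.1) hG))
    (hX.memLp_lagMonomial (lagMonomials_mono (fun x hx => mem_Ici.2 (by linarith [hx.1])) hH))]
    at hcov
  have hsplit := abs_sub_abs_le_abs_sub (∫ ω, X s₀ ω i * X s₁ ω i * (X s₂ ω i * X s₃ ω i) ∂P)
    ((∫ ω, X s₀ ω i * X s₁ ω i ∂P) * ∫ ω, X s₂ ω i * X s₃ ω i ∂P)
  have hmul := mul_le_mul hfirst hlast (abs_nonneg _) ((abs_nonneg _).trans hfirst)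
  rw [← abs_mul] at hmul
  exact sub_le_iff_le_add.1 ((sub_le_sub_left hmul _).trans (hsplit.trans hcov))

lemma integral_mul_mul_le_rateEnvelope (hX : IsAdmissibleProcess P X f)
    (hν : eLpNorm (X 0) 4 P ≤ ν) (hmean : ∀ i, ∫ ω, X 0 ω i ∂P = 0) {s₀ s₁ s₂ s₃ : ℝ}
    (h₀ : 0 ≤ s₀) (h₀₁ : s₀ ≤ s₁) (h₁₂ : s₁ ≤ s₂) (h₂₃ : s₂ ≤ s₃) (i : Fin r) :
    ∫ ω, X s₀ ω i * X s₁ ω i * (X s₂ ω i * X s₃ ω i) ∂P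
      ≤ rateEnvelope (fun T => (1 + ν ^ 4) * f T) (1 + ν ^ 4) 0 (s₁ - s₀)
        + rateEnvelope (fun T => (1 + ν ^ 4) * f T) (1 + ν ^ 4) 0 (s₂ - s₁) := by
  set M : ℝ := 1 + ν ^ 4
  have hM : 1 ≤ M := le_add_of_nonneg_right (by positivity)
  have hnonneg : ∀ x, 0 ≤ rateEnvelope (fun T => M * f T) M 0 x := fun x =>
    rateEnvelope_nonneg (fun T hT => mul_pos (by positivity) (hX.decorrelation.pos T hT))
      (by positivity)
  have htrivial : ∫ ω, X s₀ ω i * X s₁ ω i * (X s₂ ω i * X s₃ ω i) ∂P ≤ M := by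
    have h₂ : 0 ≤ s₂ := h₀.trans (h₀₁.trans h₁₂)
    have hprod := fun t u ht hu =>
      mul_mem_lagMonomials (X := X) (U := Ici 0) (s := t) (t := u) ht hu i i
    have hG := hprod s₀ s₁ h₀ (h₀.trans h₀₁)
    have hH := hprod s₂ s₃ h₂ (h₂.trans h₂₃)
    linarith [(le_abs_self _).trans
      (abs_integral_mul_le (hX.memLp_lagMonomial hG) (hX.memLp_lagMonomial hH)),
      hX.integral_lagMonomial_sq_le hν hG, hX.integral_lagMonomial_sq_le hν hH]
  rcases le_or_gt (s₁ - s₀) (0 + 1) with hp | hp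
  · rw [rateEnvelope_of_le hp]
    linarith [hnonneg (s₂ - s₁)]
  rcases le_or_gt (s₂ - s₁) (0 + 1) with hq | hq
  · rw [rateEnvelope_of_le hq]
    linarith [hnonneg (s₁ - s₀)]
  have hp0 := hnonneg (s₁ - s₀)
  have hq0 := hnonneg (s₂ - s₁)
  have hdecay := (le_abs_self _).trans
    (hX.abs_integral_mul_mul_le hν hmean h₀ (by linarith : s₀ < s₁) (by linarith) h₂₃ i)
  have hfq : f (s₂ - s₁) ≤ M * f (s₂ - s₁) :=
    le_mul_of_one_le_left (hX.decorrelation.pos _ (by linarith)).le hM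
  simp only [rateEnvelope_of_lt hp, rateEnvelope_of_lt hq, sub_zero] at hp0 hq0 ⊢
  grind

lemma integral_shiftedMean_pow_four_le (hX : IsAdmissibleProcess P X f)
    (hν : eLpNorm (X 0) 4 P ≤ ν) (hmean : ∀ i, ∫ ω, X 0 ω i ∂P = 0) {Δ : ℝ} (hΔ : 0 < Δ)
    (hΔ1 : Δ ≤ 1) (N : ℕ) {κ : ℤ} (hκ : 0 ≤ κ) (j : Fin r) :
    ∫ ω, shiftedMean X N Δ κ ω j ^ 4 ∂P
      ≤ 96 * ((1 + ν ^ 4) * (2 + ∫ T in Ioi 1, f T)) / (N * Δ) := by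
  set M : ℝ := 1 + ν ^ 4
  have hM : 0 < M := by positivity
  have : (0 : ℝ) ≤ κ := by exact_mod_cast hκ
  have hpos : ∀ T, 0 < T → 0 < M * f T := fun T hT => mul_pos hM (hX.decorrelation.pos T hT)
  have hanti : AntitoneOn (fun T => M * f T) (Ioi 0) := fun x hx y hy hxy =>
    mul_le_mul_of_nonneg_left (hX.decorrelation.antitone hx hy hxy) hM.le
  have hint := hX.decorrelation.integrable.const_mul M
  have henv := isDecayEnvelope_rateEnvelope hpos hanti hint hM.le le_rfl
  have hmass := rateEnvelope_zero_add_integral_div_le hpos hanti hint hM.le le_rfl hΔ hΔ1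
  rw [integral_const_mul] at hmass
  simp only [shiftedMean_apply]
  refine (henv.integral_mean_pow_four_le hΔ
    (fun n _ => hX.memLp_apply (by positivity) j) fun t _ ht => ?_).trans ?_
  · have hgap : ∀ {a b : ℕ}, a ≤ b → |(a : ℝ) - b| * Δ = (b + κ) * Δ - (a + κ) * Δ :=
      fun hab => by
        rw [abs_sub_comm, abs_of_nonneg (sub_nonneg.2 (by exact_mod_cast hab))]
        ring
    have hle : ∀ {k l}, k ≤ l → ((t k : ℝ) + κ) * Δ ≤ (t l + κ) * Δ := fun hkl => by
      gcongr
      exact ht hkl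
    rw [hgap (ht (by decide)), hgap (ht (by decide))]
    simpa only [Fin.prod_univ_four, mul_assoc] using hX.integral_mul_mul_le_rateEnvelope hν hmean
      (by positivity) (hle (by decide)) (hle (by decide)) (hle (k := 2) (l := 3) (by decide)) j
  · rw [mul_comm (N : ℝ), ← div_div, mul_div_assoc _ _ Δ]
    gcongr
    exact hmass.trans_eq (by ring)

lemma variance_mean_lagged_mul_le (hX : IsAdmissibleProcess P X f) (hν : eLpNorm (X 0) 4 P ≤ ν)
    {B Δ : ℝ} (hΔ : 0 < Δ) (hΔ1 : Δ ≤ 1) (N : ℕ) {κ : ℤ} (hκ : 0 ≤ κ) (hκB : κ * Δ ≤ B)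
    (i j : Fin r) :
    Var[fun ω => 1 / (N : ℝ) * ∑ n ∈ Finset.Icc 1 N, X (n * Δ) ω i * X ((n + κ) * Δ) ω j; P]
      ≤ 2 * ((1 + ν ^ 4) * (B + 2) + ∫ T in Ioi 1, f T) / (N * Δ) := by
  have hM : (0 : ℝ) ≤ 1 + ν ^ 4 := by positivity
  have : (0 : ℝ) ≤ κ := by exact_mod_cast hκ
  have hB : 0 ≤ B := le_trans (by positivity) hκB
  have hf := hX.decorrelation
  refine ((isDecayEnvelope_rateEnvelope hf.pos hf.antitone hf.integrable hM hB).variance_mean_le hΔ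
    (fun n _ => memLp_two_mul (hX.memLp_apply (by positivity) i)
      (hX.memLp_apply (by positivity) j)) fun a _ b _ => ?_).trans ?_
  · have hlag : |(a : ℝ) - b| * Δ = |a * Δ - b * Δ| := by
      rw [← sub_mul, abs_mul, abs_of_pos hΔ]
    simp only [hlag, add_mul]
    exact (le_abs_self _).trans (hX.abs_covariance_lagged_mul_le hν (by positivity)
      (by positivity) (by positivity) hκB i j)
  · rw [mul_comm (N : ℝ), ← div_div, mul_div_assoc _ _ Δ]
    gcongr
    exact rateEnvelope_zero_add_integral_div_le hf.pos hf.antitone hf.integrable hM hB hΔ hΔ1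

end IsAdmissibleProcess

lemma integral_sub_sub_sq_le {V W : Ω → ℝ} (hV : MemLp V 2 P) (hW : MemLp W 2 P) (b c : ℝ) :
    ∫ ω, (V ω - W ω - b) ^ 2 ∂P
      ≤ 3 * (∫ ω, (V ω - c) ^ 2 ∂P + (c - b) ^ 2 + ∫ ω, W ω ^ 2 ∂P) := by
  have hVc := (hV.sub (memLp_const c)).integrable_sq
  have hVcb : Integrable (fun ω => (V ω - c) ^ 2 + (c - b) ^ 2) P :=
    hVc.add (integrable_const _)
  calc ∫ ω, (V ω - W ω - b) ^ 2 ∂P ≤ ∫ ω, 3 * ((V ω - c) ^ 2 + (c - b) ^ 2 + W ω ^ 2) ∂P :=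
        integral_mono ((hV.sub hW).sub (memLp_const b)).integrable_sq
          ((hVcb.add hW.integrable_sq).const_mul 3) fun ω => by
            simp only
            linarith [sq_nonneg (V ω - c - (c - b)), sq_nonneg (V ω - c + W ω),
              sq_nonneg (c - b + W ω)]
    _ = _ := by
        rw [integral_const_mul, integral_add hVcb hW.integrable_sq]
        congr 3
        simpa using integral_add hVc (integrable_const ((c - b) ^ 2))

lemma sq_sub_round_le_of_lipschitzOnWith {K : ℝ → ℝ} {A : ℝ} {L : ℝ≥0}
    (hK : LipschitzOnWith L K (Icc 0 (A + 1))) {Δ : ℝ} (hΔ : 0 < Δ) (hΔ1 : Δ ≤ 1) {u : ℝ}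
    (hu : u ∈ Icc 0 A) : (K (round (u / Δ) * Δ) - K u) ^ 2 ≤ (L * Δ) ^ 2 := by
  have hround := abs_round_div_mul_sub_le hΔ u
  have hκ : (0 : ℝ) ≤ round (u / Δ) := by exact_mod_cast round_div_nonneg hΔ hu.1
  have h := hK.dist_le_mul (round (u / Δ) * Δ)
    ⟨by positivity, by linarith [(abs_le.1 hround).2, hu.2]⟩ u ⟨hu.1, by linarith [hu.2]⟩
  rw [Real.dist_eq, Real.dist_eq] at h
  rw [← sq_abs]
  gcongr
  exact h.trans (by gcongr; linarith)

/-- Numerator of the bound `fluctuationConst A I M / (N Δ)` for the random part of the mean square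
error of an entry of the empirical covariance at lags in `[0, A]`, for a centred process with moment
bound `M` and rate integral at most `I`: the first summand comes from the lagged products, the
second from the product of the two empirical means. -/
noncomputable def fluctuationConst (A I M : ℝ) : ℝ :=
  2 * (M * (A + 3) + I) + 96 * (M * (2 + I))

lemma fluctuationConst_nonneg {A I M : ℝ} (hA : 0 ≤ A) (hI : 0 ≤ I) (hM : 0 ≤ M) :
    0 ≤ fluctuationConst A I M := by
  unfold fluctuationConst
  positivity

namespace IsAdmissibleProcess

lemma integral_mean_lagged_mul (hX : IsAdmissibleProcess P X f)
    (hmean : ∀ i, ∫ ω, X 0 ω i ∂P = 0) {Δ : ℝ} (hΔ : 0 < Δ) {N : ℕ} (hN : N ≠ 0) {κ : ℤ}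
    (hκ : 0 ≤ κ) (i j : Fin r) :
    ∫ ω, 1 / (N : ℝ) * ∑ n ∈ Finset.Icc 1 N, X (n * Δ) ω i * X ((n + κ) * Δ) ω j ∂P
      = laggedCov P X (κ * Δ) i j := by
  have : (0 : ℝ) ≤ κ := by exact_mod_cast hκ
  have hterm : ∀ n : ℕ, ∫ ω, X (n * Δ) ω i * X (n * Δ + κ * Δ) ω j ∂P
      = ∫ ω, X 0 ω i * X (κ * Δ) ω j ∂P := fun n =>
    hX.integral_mul_apply (by positivity) (by positivity) i j
  rw [integral_const_mul, integral_finsetSum _ fun n _ => (memLp_two_mul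
    (hX.memLp_apply (by positivity) i) (hX.memLp_apply (by positivity) j)).integrable (by norm_num)]
  simp [add_mul, hterm, laggedCov, hmean, hN]

lemma integral_shiftedMean_mul_sq_le (hX : IsAdmissibleProcess P X f)
    (hν : eLpNorm (X 0) 4 P ≤ ν) (hmean : ∀ i, ∫ ω, X 0 ω i ∂P = 0) {Δ : ℝ} (hΔ : 0 < Δ)
    (hΔ1 : Δ ≤ 1) (N : ℕ) {κ : ℤ} (hκ : 0 ≤ κ) (i j : Fin r) :
    ∫ ω, (shiftedMean X N Δ 0 ω i * shiftedMean X N Δ κ ω j) ^ 2 ∂P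
      ≤ 96 * ((1 + ν ^ 4) * (2 + ∫ T in Ioi 1, f T)) / (N * Δ) := by
  have h := integral_mul_sq_le (hX.memLp_shiftedMean hΔ N le_rfl i) (hX.memLp_shiftedMean hΔ N hκ j)
  linarith [hX.integral_shiftedMean_pow_four_le hν hmean hΔ hΔ1 N le_rfl i,
    hX.integral_shiftedMean_pow_four_le hν hmean hΔ hΔ1 N hκ j]

lemma integral_sq_empiricalCov_sub_le (hX : IsAdmissibleProcess P X f)
    (hν : eLpNorm (X 0) 4 P ≤ ν) (hmean : ∀ i, ∫ ω, X 0 ω i ∂P = 0) {A I : ℝ} {L : ℝ≥0}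
    (hI : ∫ T in Ioi 1, f T ≤ I) {i j : Fin r}
    (hL : LipschitzOnWith L (fun u => laggedCov P X u i j) (Icc 0 (A + 1)))
    {Δ : ℝ} (hΔ : 0 < Δ) (hΔ1 : Δ ≤ 1) {N : ℕ} (hN : N ≠ 0) {u : ℝ} (hu : u ∈ Icc 0 A) :
    ∫ ω, (empiricalCov X N Δ u ω i j - laggedCov P X u i j) ^ 2 ∂P
      ≤ 3 * (fluctuationConst A I (1 + ν ^ 4) / (N * Δ) + (L * Δ) ^ 2) := by
  have hbias := sq_sub_round_le_of_lipschitzOnWith hL hΔ hΔ1 hu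
  have hround := abs_round_div_mul_sub_le hΔ u
  have hκ : 0 ≤ round (u / Δ) := round_div_nonneg hΔ hu.1
  simp only [empiricalCov_apply]
  set κ := round (u / Δ)
  have : (0 : ℝ) ≤ κ := by exact_mod_cast hκ
  set V : Ω → ℝ := fun ω => 1 / (N : ℝ) * ∑ n ∈ Finset.Icc 1 N, X (n * Δ) ω i * X ((n + κ) * Δ) ω j
  have hV : MemLp V 2 P := (memLp_finsetSum _ fun n _ => memLp_two_mul
    (hX.memLp_apply (by positivity) i) (hX.memLp_apply (by positivity) j)).const_mul _
  have hvar : ∫ ω, (V ω - laggedCov P X (κ * Δ) i j) ^ 2 ∂P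
      ≤ 2 * ((1 + ν ^ 4) * (A + 3) + I) / (N * Δ) := by
    rw [← hX.integral_mean_lagged_mul hmean hΔ hN hκ, ← variance_eq_integral hV.aemeasurable,
      show A + 3 = A + 1 + 2 by ring]
    exact (hX.variance_mean_lagged_mul_le hν (B := A + 1) hΔ hΔ1 N hκ
      (by linarith [(abs_le.1 hround).2, hu.2]) i j).trans (by gcongr)
  have hmeans : ∫ ω, (shiftedMean X N Δ 0 ω i * shiftedMean X N Δ κ ω j) ^ 2 ∂P
      ≤ 96 * ((1 + ν ^ 4) * (2 + I)) / (N * Δ) :=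
    (hX.integral_shiftedMean_mul_sq_le hν hmean hΔ hΔ1 N hκ i j).trans (by gcongr)
  refine (integral_sub_sub_sq_le hV (memLp_two_mul (hX.memLp_shiftedMean hΔ N le_rfl i)
    (hX.memLp_shiftedMean hΔ N hκ j)) _ (laggedCov P X (κ * Δ) i j)).trans ?_
  rw [fluctuationConst, add_div]
  linarith

lemma integral_sub_mean (hX : IsAdmissibleProcess P X f) (i : Fin r) :
    ∫ ω, (X 0 ω - fun k => ∫ ω', X 0 ω' k ∂P) i ∂P = 0 := by
  have h := integral_sub ((hX.memLp_apply le_rfl i).integrable (by norm_num))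
    (integrable_const (μ := P) (∫ ω, X 0 ω i ∂P))
  simpa using h

lemma abs_mean_le (hX : IsAdmissibleProcess P X f) (hν : eLpNorm (X 0) 4 P ≤ ν) (i : Fin r) :
    |∫ ω, X 0 ω i ∂P| ≤ ν := by
  have hone : eLpNorm (fun ω => X 0 ω i) 1 P ≤ ν :=
    (eLpNorm_le_eLpNorm_of_exponent_le (by norm_num)
      (hX.memLp_apply le_rfl i).aestronglyMeasurable).trans
      ((eLpNorm_mono fun ω => norm_le_pi_norm (X 0 ω) i).trans hν)
  rw [eLpNorm_one_eq_lintegral_enorm] at hone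
  exact_mod_cast (enorm_integral_le_lintegral_enorm _).trans hone

lemma eLpNorm_sub_mean_le (hX : IsAdmissibleProcess P X f) (hν : eLpNorm (X 0) 4 P ≤ ν) :
    eLpNorm (fun ω => X 0 ω - fun k => ∫ ω', X 0 ω' k ∂P) 4 P ≤ (2 * ν : ℝ≥0) := by
  have hmean : ‖fun k => ∫ ω, X 0 ω k ∂P‖ₑ ≤ ν := by
    exact_mod_cast (pi_norm_le_iff_of_nonneg ν.coe_nonneg).2 (hX.abs_mean_le hν)
  refine (eLpNorm_sub_le (hX.memLp 0 le_rfl).aestronglyMeasurable aestronglyMeasurable_const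
    (by norm_num)).trans ?_
  rw [eLpNorm_const _ (by norm_num) (IsProbabilityMeasure.ne_zero P), measure_univ,
    ENNReal.one_rpow, mul_one, ENNReal.coe_mul, ENNReal.coe_ofNat, two_mul]
  exact add_le_add hν hmean

lemma eLpNorm_empiricalCov_sub_le (hX : IsAdmissibleProcess P X f)
    (hν : eLpNorm (X 0) 4 P ≤ ν) (hmean : ∀ i, ∫ ω, X 0 ω i ∂P = 0) {A I : ℝ} {L : ℝ≥0}
    (hI : ∫ T in Ioi 1, f T ≤ I) {i j : Fin r}
    (hL : LipschitzOnWith L (fun u => laggedCov P X u i j) (Icc 0 (A + 1)))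
    {Δ : ℝ} (hΔ : 0 < Δ) (hΔ1 : Δ ≤ 1) {N : ℕ} (hN : N ≠ 0) {u : ℝ} (hu : u ∈ Icc 0 A) :
    eLpNorm (fun ω => empiricalCov X N Δ u ω i j - laggedCov P X u i j) 2 P
      ≤ ENNReal.ofReal (√(3 * (fluctuationConst A I (1 + ν ^ 4) / (N * Δ) + (L * Δ) ^ 2))) := by
  have hLp := (hX.memLp_empiricalCov hΔ N hu.1 i j).sub (memLp_const (laggedCov P X u i j))
  have hsq := eLpNorm_pow_eq_ofReal_integral_pow even_two two_ne_zero hLp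
  rw [← ENNReal.pow_le_pow_left_iff two_ne_zero]
  refine hsq.trans_le ?_
  rw [← ENNReal.ofReal_pow (Real.sqrt_nonneg _)]
  have hle := hX.integral_sq_empiricalCov_sub_le hν hmean hI hL hΔ hΔ1 hN hu
  have hnonneg := (integral_nonneg fun ω => sq_nonneg (empiricalCov X N Δ u ω i j
    - laggedCov P X u i j)).trans hle
  exact ENNReal.ofReal_le_ofReal (hle.trans_eq (Real.sq_sqrt hnonneg).symm)

end IsAdmissibleProcess

/-- Bound for the random part of the mean square error of an entry of the empirical covariance, up
to the factor `1 / (N Δ)`, when `ν` bounds the `L⁴` norm of a process that need not be centred: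
centring at most doubles `ν` and multiplies the decorrelation rate by `(1 + 2 ν)²`. -/
noncomputable def noncentredFluctuationConst (A I ν : ℝ) : ℝ :=
  fluctuationConst A ((1 + 2 * ν) ^ 2 * I) (1 + (2 * ν) ^ 4)

lemma IsAdmissibleProcess.covError_le (hX : IsAdmissibleProcess P X f)
    (hν : eLpNorm (X 0) 4 P ≤ ν) {A I : ℝ} {L : ℝ≥0} (hI : ∫ T in Ioi 1, f T ≤ I)
    (hL : ∀ i j, LipschitzOnWith L (fun u => laggedCov P X u i j) (Icc 0 (A + 1)))
    {Δ : ℝ} (hΔ : 0 < Δ) (hΔ1 : Δ ≤ 1) {N : ℕ} (hN : N ≠ 0) {u : ℝ} (hu : u ∈ Icc 0 A) :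
    covError P X N Δ u ≤ ENNReal.ofReal
      (r ^ 2 * √(3 * (noncentredFluctuationConst A I ν / (N * Δ) + (L * Δ) ^ 2))) := by
  set m : Fin r → ℝ := fun k => ∫ ω, X 0 ω k ∂P
  have hY := hX.sub_const ν.coe_nonneg (hX.abs_mean_le hν)
  have hIY : ∫ T in Ioi 1, (1 + 2 * (ν : ℝ)) ^ 2 * f T ≤ (1 + 2 * ν) ^ 2 * I := by
    rw [integral_const_mul]
    gcongr
  have hLY : ∀ i j,
      LipschitzOnWith L (fun u => laggedCov P (fun t ω => X t ω - m) u i j) (Icc 0 (A + 1)) :=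
    fun i j u hu v hv => by
      simp only [hX.laggedCov_sub_const m hu.1, hX.laggedCov_sub_const m hv.1]
      exact hL i j hu hv
  have hentry := fun i j => hY.eLpNorm_empiricalCov_sub_le (hX.eLpNorm_sub_mean_le hν)
    hX.integral_sub_mean hIY (hLY i j) hΔ hΔ1 hN hu
  rw [← hX.covError_sub_const hN hu.1 m, ENNReal.ofReal_mul (by positivity),
    ENNReal.ofReal_pow (by positivity), ENNReal.ofReal_natCast]
  exact covError_le_of_forall_eLpNorm_le
    (fun i j => (hY.memLp_empiricalCov hΔ N hu.1 i j).aestronglyMeasurable) hentry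

end UpperBound

section Rate

lemma cast_eq_rpow_third_pow (N : ℕ) : ((N : ℝ) ^ (1 / 3 : ℝ)) ^ 3 = N := by
  rw [← Real.rpow_natCast, ← Real.rpow_mul (Nat.cast_nonneg N)]
  norm_num

/-- Squaring the bound at the optimal time step: if `Δ` lies between `(c / 2) y⁻¹` and `2 c y⁻¹`,
where `y³` is the number of observations, then `√(3 (F / (y³ Δ) + (L Δ)²)) ≤ C / y` with this
constant `C`. -/
noncomputable def balancedRateConst (F L c : ℝ) : ℝ :=
  √(3 * (2 * F / c + (2 * L * c) ^ 2))

lemma sqrt_le_balancedRateConst_div {F L c y Δ : ℝ} (hF : 0 ≤ F) (hL : 0 ≤ L) (hc : 0 < c)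
    (hy : 0 < y) (hΔ : 0 < Δ) (hlower : c / 2 ≤ Δ * y) (hupper : Δ * y ≤ 2 * c) :
    √(3 * (F / (y ^ 3 * Δ) + (L * Δ) ^ 2)) ≤ balancedRateConst F L c * (1 / y) := by
  have hrandom : F / (y ^ 3 * Δ) ≤ 2 * F / c * (1 / y) ^ 2 :=
    calc F / (y ^ 3 * Δ) = F / (y ^ 2 * (Δ * y)) := by ring
      _ ≤ F / (y ^ 2 * (c / 2)) := by gcongr
      _ = 2 * F / c * (1 / y) ^ 2 := by field_simp
  have hbias : (L * Δ) ^ 2 ≤ (2 * L * c) ^ 2 * (1 / y) ^ 2 :=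
    calc (L * Δ) ^ 2 ≤ (L * (2 * c / y)) ^ 2 := by gcongr; exact (le_div_iff₀ hy).2 hupper
      _ = (2 * L * c) ^ 2 * (1 / y) ^ 2 := by ring
  refine Real.sqrt_le_iff.2 ⟨by unfold balancedRateConst; positivity, ?_⟩
  rw [balancedRateConst, mul_pow (√_), Real.sq_sqrt (by positivity)]
  linarith

variable {Ω : Type*} [MeasurableSpace Ω] {P : Measure Ω} {r : ℕ} {X : ℝ → Ω → Fin r → ℝ}
  {f : ℝ → ℝ}

lemma HasIntegrableDecorrelationRate.setIntegral_nonneg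
    (hf : HasIntegrableDecorrelationRate P X f) : 0 ≤ ∫ T in Ioi 1, f T :=
  MeasureTheory.setIntegral_nonneg measurableSet_Ioi fun T hT => (hf.pos T (one_pos.trans hT)).le

lemma IsAdmissibleProcess.eventually_covError_le [IsProbabilityMeasure P]
    (hX : IsAdmissibleProcess P X f) {A I c : ℝ} {ν L : ℝ≥0} (hc : 0 < c)
    (hν : eLpNorm (X 0) 4 P ≤ ν) (hI : ∫ T in Ioi 1, f T ≤ I)
    (hL : ∀ i j, LipschitzOnWith L (fun u => laggedCov P X u i j) (Icc 0 (A + 1)))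
    {N : ℝ → ℕ} {Δ : ℝ → ℝ} (hΔ : ∀ ε, 0 < ε → 0 < Δ ε) (hN : Tendsto N (𝓝[>] 0) atTop)
    (hΔN : Tendsto (fun ε => Δ ε / (1 / (N ε : ℝ) ^ (1 / 3 : ℝ))) (𝓝[>] 0) (𝓝 c)) :
    ∀ᶠ ε in 𝓝[>] (0 : ℝ), ∀ u ∈ Icc 0 A, covError P X (N ε) (Δ ε) u ≤ ENNReal.ofReal
      (r ^ 2 * balancedRateConst (noncentredFluctuationConst A I ν) L c
        * (1 / (N ε : ℝ) ^ (1 / 3 : ℝ))) := by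
  have hroot : Tendsto (fun ε => (N ε : ℝ) ^ (1 / 3 : ℝ)) (𝓝[>] 0) atTop :=
    (tendsto_rpow_atTop (by norm_num)).comp (tendsto_natCast_atTop_atTop.comp hN)
  filter_upwards [self_mem_nhdsWithin, hN.eventually_ge_atTop 1, hroot.eventually_gt_atTop 0,
    hroot.eventually_ge_atTop (2 * c), hΔN.eventually_le_const (show c < 2 * c by linarith),
    hΔN.eventually_const_le (show c / 2 < c by linarith)] with ε hε hN1 hy hyc hupper hlower u hu
  set y := (N ε : ℝ) ^ (1 / 3 : ℝ)
  rw [div_div_eq_mul_div, div_one] at hupper hlower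
  have hΔ1 : Δ ε ≤ 1 := le_of_mul_le_mul_right (by linarith) hy
  have hA : 0 ≤ A := hu.1.trans hu.2
  have hI0 : 0 ≤ I := hX.decorrelation.setIntegral_nonneg.trans hI
  refine (hX.covError_le hν hI hL (hΔ ε hε) hΔ1 (by omega) hu).trans (ENNReal.ofReal_le_ofReal ?_)
  rw [mul_assoc, ← cast_eq_rpow_third_pow (N ε)]
  gcongr
  exact sqrt_le_balancedRateConst_div (fluctuationConst_nonneg hA (by positivity) (by positivity))
    L.coe_nonneg hc hy (hΔ ε hε) hlower hupper

end Rate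

section Isonormal

section CentredGaussian

variable {Ω : Type*} [MeasurableSpace Ω] {P : Measure Ω}

lemma isClosed_setOf_hasLaw_gaussianReal_nnnorm_sq [IsProbabilityMeasure P] :
    IsClosed {Z : Lp ℝ 2 P | HasLaw Z (gaussianReal 0 (‖Z‖₊ ^ 2)) P} := by
  refine IsSeqClosed.isClosed fun Z Z' hZ hlim => ?_
  have hmeas : ∀ Y : Lp ℝ 2 P, AEMeasurable Y P := fun Y => (Lp.aestronglyMeasurable Y).aemeasurable
  have hdist := (tendstoInMeasure_of_tendsto_Lp hlim).tendstoInDistribution fun n => hmeas (Z n)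
  have hchar := ProbabilityMeasure.tendsto_iff_tendsto_charFun.1 hdist.tendsto
  have := Measure.isProbabilityMeasure_map (hmeas Z')
  refine ⟨hmeas Z', Measure.ext_of_charFun (funext fun s => tendsto_nhds_unique (hchar s) ?_)⟩
  simp only [ProbabilityMeasure.coe_mk, (hZ _).map_eq, charFun_gaussianReal]
  have hcont : Continuous fun Y : Lp ℝ 2 P =>
      Complex.exp (s * (0 : ℝ) * Complex.I - ((‖Y‖₊ ^ 2 : ℝ≥0) : ℝ) * s ^ 2 / 2) := by fun_prop
  exact (hcont.tendsto Z').comp hlim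

lemma hasLaw_gaussianReal_nnnorm_sq_of_hasGaussianLaw {Z : Lp ℝ 2 P}
    (hZ : HasGaussianLaw Z P) (hmean : ∫ ω, Z ω ∂P = 0) :
    HasLaw Z (gaussianReal 0 (‖Z‖₊ ^ 2)) P := by
  refine ⟨hZ.aemeasurable, ?_⟩
  have hvar : Var[Z; P] = ‖Z‖ ^ 2 := by
    rw [variance_of_integral_eq_zero hZ.aemeasurable hmean, ← real_inner_self_eq_norm_sq,
      L2.inner_def]
    simp [sq]
  rw [hZ.map_eq_gaussianReal, hmean, hvar, Real.toNNReal_pow (norm_nonneg Z), norm_toNNReal]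

lemma orthonormal_toLp_of_iIndepFun [IsProbabilityMeasure P] {ι : Type*} {ξ : ι → Ω → ℝ}
    (hind : iIndepFun ξ P) (hLp : ∀ i, MemLp (ξ i) 2 P) (hmean : ∀ i, ∫ ω, ξ i ω ∂P = 0)
    (hvar : ∀ i, Var[ξ i; P] = 1) : Orthonormal ℝ fun i => (hLp i).toLp (ξ i) := by
  classical
  have hinner : ∀ i j, inner ℝ ((hLp i).toLp (ξ i)) ((hLp j).toLp (ξ j)) = cov[ξ i, ξ j; P] :=
    fun i j => by
      rw [L2.inner_def, covariance_eq_sub (hLp i) (hLp j), hmean i, zero_mul, sub_zero]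
      refine integral_congr_ae ?_
      filter_upwards [(hLp i).coeFn_toLp, (hLp j).coeFn_toLp] with ω hi hj
      simp [hi, hj, mul_comm]
  refine orthonormal_iff_ite.2 fun i j => ?_
  rw [hinner]
  split_ifs with hij
  · rw [hij, covariance_self (hLp j).aemeasurable, hvar]
  · exact (hind.indepFun hij).covariance_eq_zero (hLp i) (hLp j)

lemma coeFn_sum_smul {ι : Type*} (s : Finset ι) (c : ι → ℝ) (Z : ι → Lp ℝ 2 P) :
    ⇑(∑ i ∈ s, c i • Z i) =ᵐ[P] fun ω => ∑ i ∈ s, c i * Z i ω := by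
  have hterm : ∀ᵐ ω ∂P, ∀ i ∈ s, (c i • Z i : Lp ℝ 2 P) ω = c i * Z i ω :=
    (Finset.eventually_all s).2 fun i _ => Lp.coeFn_smul (c i) (Z i)
  filter_upwards [Lp.coeFn_finsetSum s fun i => c i • Z i, hterm] with ω hsum hω
  rw [hsum, Finset.sum_apply, Finset.sum_congr rfl hω]

lemma hasLaw_sum_smul_toLp_of_iIndepFun {ι : Type*} {ξ : ι → Ω → ℝ}
    (hind : iIndepFun ξ P) (hξ : ∀ i, HasLaw (ξ i) (gaussianReal 0 1) P)
    (hLp : ∀ i, MemLp (ξ i) 2 P) (c : ι → ℝ) (s : Finset ι) :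
    HasLaw (∑ i ∈ s, c i • (hLp i).toLp (ξ i) : Lp ℝ 2 P)
      (gaussianReal 0 (‖∑ i ∈ s, c i • (hLp i).toLp (ξ i)‖₊ ^ 2)) P := by
  have := hind.isProbabilityMeasure
  have hae : (∑ i ∈ s, c i • (hLp i).toLp (ξ i) : Lp ℝ 2 P)
      =ᵐ[P] fun ω => ∑ i ∈ s, c i * ξ i ω := by
    have hterm := (Finset.eventually_all s).2 fun i _ => (hLp i).coeFn_toLp
    filter_upwards [coeFn_sum_smul s c fun i => (hLp i).toLp (ξ i), hterm] with ω hsum hω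
    rw [hsum]
    exact Finset.sum_congr rfl fun i hi => by rw [hω i hi]
  refine hasLaw_gaussianReal_nnnorm_sq_of_hasGaussianLaw (HasGaussianLaw.congr ?_ hae.symm) ?_
  · have hsum := iIndepFun.hasGaussianLaw_fun_sum (X := fun (i : s) ω => c i * ξ i ω)
      (fun i => (hξ i).hasGaussianLaw.map_fun (c i • ContinuousLinearMap.id ℝ ℝ))
      ((hind.precomp Subtype.val_injective).comp (fun (i : s) (x : ℝ) => c i * x)
        fun i => measurable_const_mul (c i))
    exact hsum.congr (ae_of_all _ fun ω => Finset.sum_coe_sort s fun i => c i * ξ i ω)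
  · rw [integral_congr_ae hae,
      integral_finsetSum _ fun i _ => ((hLp i).integrable one_le_two).const_mul _]
    simp [integral_const_mul, (hξ _).integral_eq, integral_id_gaussianReal]

lemma integral_pow_four_gaussianReal_two_mul (v : ℝ≥0) :
    ∫ x, x ^ 4 ∂(gaussianReal 0 (v + v)) = 4 * ∫ x, x ^ 4 ∂(gaussianReal 0 v) := by
  have hlaw : gaussianReal 0 (v + v) = (gaussianReal 0 v).map (fun x => √2 * x) := by
    rw [gaussianReal_map_const_mul, mul_zero]
    congr 1
    ext
    simp [two_mul]
  rw [hlaw, integral_map (by fun_prop) (by fun_prop), ← integral_const_mul]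
  congr! 2
  rw [mul_pow, show (√2 : ℝ) ^ 4 = (√2 ^ 2) ^ 2 by ring, Real.sq_sqrt zero_le_two]
  norm_num

lemma integral_add_pow_four_add_sub_pow_four {μ : Measure ℝ} [IsProbabilityMeasure μ]
    (hμ : ∀ n : ℕ, Integrable (fun x => x ^ n) μ) :
    ∫ p : ℝ × ℝ, ((p.1 + p.2) ^ 4 + (p.1 - p.2) ^ 4) ∂(μ.prod μ)
      = 4 * ∫ x, x ^ 4 ∂μ + 12 * (∫ x, x ^ 2 ∂μ) ^ 2 := by
  have hprod : Integrable (fun p : ℝ × ℝ => p.1 ^ 2 * p.2 ^ 2) (μ.prod μ) := (hμ 2).mul_prod (hμ 2)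
  have hexpand : ∀ p : ℝ × ℝ, (p.1 + p.2) ^ 4 + (p.1 - p.2) ^ 4
      = 2 * p.1 ^ 4 + 2 * p.2 ^ 4 + 12 * (p.1 ^ 2 * p.2 ^ 2) := fun p => by ring
  simp only [hexpand]
  have hfst : Integrable (fun p : ℝ × ℝ => 2 * p.1 ^ 4) (μ.prod μ) :=
    ((hμ 4).comp_fst μ).const_mul 2
  have hsnd : Integrable (fun p : ℝ × ℝ => 2 * p.2 ^ 4) (μ.prod μ) :=
    ((hμ 4).comp_snd μ).const_mul 2
  rw [integral_add (hfst.fun_add hsnd) (hprod.const_mul 12), integral_add hfst hsnd]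
  simp only [integral_const_mul]
  rw [integral_fun_fst (fun x : ℝ => x ^ 4), integral_fun_snd (fun x : ℝ => x ^ 4),
    integral_prod_mul (fun x : ℝ => x ^ 2) (fun x : ℝ => x ^ 2)]
  simp only [probReal_univ, one_smul]
  ring

lemma integrable_pow_gaussianReal (m : ℝ) (v : ℝ≥0) (n : ℕ) :
    Integrable (fun x => x ^ n) (gaussianReal m v) := by
  have := (memLp_id_gaussianReal (μ := m) (v := v) n).integrable_norm_pow'
  exact (integrable_norm_iff (by fun_prop)).1 (by simpa using this)

lemma integral_sq_gaussianReal (v : ℝ≥0) : ∫ x, x ^ 2 ∂(gaussianReal 0 v) = v := by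
  have h := variance_of_integral_eq_zero (X := id) (μ := gaussianReal 0 v) aemeasurable_id
    integral_id_gaussianReal
  rw [variance_id_gaussianReal] at h
  simpa using h.symm

/-- For independent `x`, `y` with law `N(0, v)`, both `x + y` and `x - y` have law `N(0, 2v)`, so
taking expectations in `(x + y)⁴ + (x - y)⁴ = 2x⁴ + 12x²y² + 2y⁴` gives `8m = 4m + 12v²` for the
fourth moment `m`. -/
lemma integral_pow_four_gaussianReal (v : ℝ≥0) :
    ∫ x, x ^ 4 ∂(gaussianReal 0 v) = 3 * (v : ℝ) ^ 2 := by
  set μ := gaussianReal 0 v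
  have hfst : (μ.prod μ).map Prod.fst = μ := measurePreserving_fst.map_eq
  have hsnd : (μ.prod μ).map Prod.snd = μ := measurePreserving_snd.map_eq
  have hind : Prod.fst ⟂ᵢ[μ.prod μ] Prod.snd := indepFun_prod measurable_id measurable_id
  have hadd : (μ.prod μ).map (fun p => p.1 + p.2) = gaussianReal 0 (v + v) := by
    have h := gaussianReal_add_gaussianReal_of_indepFun hind hfst hsnd
    rwa [add_zero] at h
  have hsub : (μ.prod μ).map (fun p => p.1 - p.2) = gaussianReal 0 (v + v) := by
    have h := gaussianReal_add_gaussianReal_of_indepFun (hind.comp measurable_id measurable_neg)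
      hfst (gaussianReal_neg ⟨by fun_prop, hsnd⟩).map_eq
    rw [neg_zero, add_zero] at h
    rw [← h]
    exact congrArg (Measure.map · _) (funext fun p => sub_eq_add_neg p.1 p.2)
  have hmoment : ∀ φ : ℝ × ℝ → ℝ, Measurable φ → (μ.prod μ).map φ = gaussianReal 0 (v + v) →
      Integrable (fun p => φ p ^ 4) (μ.prod μ)
        ∧ ∫ p, φ p ^ 4 ∂(μ.prod μ) = 4 * ∫ x, x ^ 4 ∂μ := fun φ hφ hlaw => by
    have hlaw' : HasLaw φ (gaussianReal 0 (v + v)) (μ.prod μ) := ⟨hφ.aemeasurable, hlaw⟩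
    rw [← integral_pow_four_gaussianReal_two_mul]
    refine ⟨?_, hlaw'.integral_comp (f := fun x => x ^ 4) (by fun_prop)⟩
    exact (hlaw ▸ integrable_pow_gaussianReal 0 (v + v) 4).comp_measurable hφ
  obtain ⟨hint_add, h_add⟩ := hmoment _ (by fun_prop) hadd
  obtain ⟨hint_sub, h_sub⟩ := hmoment _ (by fun_prop) hsub
  have h := integral_add_pow_four_add_sub_pow_four (integrable_pow_gaussianReal 0 v)
  rw [integral_add hint_add hint_sub, h_add, h_sub, integral_sq_gaussianReal] at h
  linarith

end CentredGaussian

section Existence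

variable {H : Type*} [NormedAddCommGroup H] [InnerProductSpace ℝ H]

/-- An isonormal Gaussian process over the Hilbert space `H`: a linear isometry of `H` into `L²(P)`
all of whose values are centred Gaussian variables. -/
def IsIsonormal {Ω : Type*} [MeasurableSpace Ω] {P : Measure Ω} (W : H →ₗᵢ[ℝ] Lp ℝ 2 P) : Prop :=
  ∀ h, HasLaw (W h) (gaussianReal 0 (‖h‖₊ ^ 2)) P

/-- Independent standard Gaussian variables are orthonormal in `L²`, so sending a Hilbert basis to
them extends to an isometry; its values are `L²` limits of centred Gaussian variables. -/
lemma exists_isonormal (H : Type) [NormedAddCommGroup H] [InnerProductSpace ℝ H]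
    [CompleteSpace H] :
    ∃ (Ω : Type) (_ : MeasurableSpace Ω) (P : Measure Ω) (_ : IsProbabilityMeasure P)
      (W : H →ₗᵢ[ℝ] Lp ℝ 2 P), IsIsonormal W := by
  obtain ⟨w, b, -⟩ := exists_hilbertBasis ℝ H
  obtain ⟨Ω, mΩ, P, ξ, -, hξ, hind, hP⟩ := exists_iid w (gaussianReal 0 1)
  have hLp : ∀ i, MemLp (ξ i) 2 P := fun i => (hξ i).hasGaussianLaw.memLp_two
  have hort := orthonormal_toLp_of_iIndepFun hind hLp
    (fun i => by rw [(hξ i).integral_eq, integral_id_gaussianReal])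
    (fun i => by rw [(hξ i).variance_eq, variance_id_gaussianReal, NNReal.coe_one])
  refine ⟨Ω, mΩ, P, hP,
    hort.orthogonalFamily.linearIsometry.comp b.repr.toLinearIsometry, fun h => ?_⟩
  have hsum := hort.orthogonalFamily.hasSum_linearIsometry (b.repr h)
  have hmem := isClosed_setOf_hasLaw_gaussianReal_nnnorm_sq.mem_of_tendsto hsum
    (Eventually.of_forall fun s => hasLaw_sum_smul_toLp_of_iIndepFun hind hξ hLp (b.repr h) s)
  simpa [LinearIsometry.nnnorm_map] using hmem

end Existence

section IsonormalMoments

variable {H : Type*} [NormedAddCommGroup H] [InnerProductSpace ℝ H]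
variable {Ω : Type*} [MeasurableSpace Ω] {P : Measure Ω} {W : H →ₗᵢ[ℝ] Lp ℝ 2 P}

lemma integral_mul_eq_inner_isonormal (W : H →ₗᵢ[ℝ] Lp ℝ 2 P) (a b : H) :
    ∫ ω, W a ω * W b ω ∂P = inner ℝ a b := by
  rw [← W.inner_map_map, L2.inner_def]
  simp [mul_comm]

lemma IsIsonormal.integral_eq_zero (hW : IsIsonormal W) (h : H) : ∫ ω, W h ω ∂P = 0 := by
  rw [(hW h).integral_eq, integral_id_gaussianReal]

lemma IsIsonormal.memLp_four (hW : IsIsonormal W) (h : H) : MemLp (W h) 4 P :=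
  (hW h).hasGaussianLaw.memLp (by simp)

lemma IsIsonormal.integral_pow_four (hW : IsIsonormal W) (h : H) :
    ∫ ω, W h ω ^ 4 ∂P = 3 * ‖h‖ ^ 4 := by
  have hcomp := (hW h).integral_comp (f := fun x => x ^ 4) (by fun_prop)
  simp only [Function.comp_def] at hcomp
  rw [hcomp, integral_pow_four_gaussianReal]
  push_cast
  ring

/-- Polarisation: `12x²y² = (x + y)⁴ + (x - y)⁴ - 2x⁴ - 2y⁴`, and all the fourth powers on the right
are taken of centred Gaussian variables. -/
lemma IsIsonormal.integral_sq_mul_sq (hW : IsIsonormal W) (a b : H) :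
    ∫ ω, W a ω ^ 2 * W b ω ^ 2 ∂P = ‖a‖ ^ 2 * ‖b‖ ^ 2 + 2 * inner ℝ a b ^ 2 := by
  have hint : ∀ h, Integrable (fun ω => W h ω ^ 4) P := fun h =>
    integrable_pow_four (hW.memLp_four h)
  have hpolar : (fun ω => W a ω ^ 2 * W b ω ^ 2) =ᵐ[P] fun ω =>
      1 / 12 * ((W (a + b) ω ^ 4 + W (a - b) ω ^ 4) - 2 * (W a ω ^ 4 + W b ω ^ 4)) := by
    filter_upwards [Lp.coeFn_add (W a) (W b), Lp.coeFn_sub (W a) (W b)] with ω hadd hsub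
    rw [map_add, map_sub, hadd, hsub, Pi.add_apply, Pi.sub_apply]
    ring
  rw [integral_congr_ae hpolar, integral_const_mul,
    integral_sub ((hint _).fun_add (hint _)) (((hint _).fun_add (hint _)).const_mul 2),
    integral_const_mul, integral_add (hint _) (hint _), integral_add (hint _) (hint _)]
  simp only [hW.integral_pow_four]
  have hadd := norm_add_sq_real a b
  have hsub := norm_sub_sq_real a b
  rw [show ‖a + b‖ ^ 4 = (‖a + b‖ ^ 2) ^ 2 by ring, show ‖a - b‖ ^ 4 = (‖a - b‖ ^ 2) ^ 2 by ring,
    hadd, hsub]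
  ring

end IsonormalMoments

section IsonormalJointLaws

variable {H : Type*} [NormedAddCommGroup H] [InnerProductSpace ℝ H]
variable {Ω : Type*} [MeasurableSpace Ω] {P : Measure Ω} {W : H →ₗᵢ[ℝ] Lp ℝ 2 P}

lemma IsIsonormal.hasLaw_dual (hW : IsIsonormal W) {ι : Type*} [Fintype ι] [DecidableEq ι]
    (g : ι → H) (L : StrongDual ℝ (ι → ℝ)) :
    HasLaw (fun ω => L fun i => W (g i) ω)
      (gaussianReal 0 (‖∑ i, L (Pi.single i 1) • g i‖₊ ^ 2)) P := by
  refine (hW _).congr ?_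
  filter_upwards [coeFn_sum_smul Finset.univ (fun i => L (Pi.single i 1)) fun i => W (g i)]
    with ω hω
  simp only [map_sum, map_smul]
  rw [hω]
  conv_lhs => rw [pi_eq_sum_univ' (fun i => W (g i) ω), map_sum]
  exact Finset.sum_congr rfl fun i _ => by rw [map_smul, smul_eq_mul, mul_comm]

lemma aemeasurable_isonormal {ι : Type*} [Countable ι] (W : H →ₗᵢ[ℝ] Lp ℝ 2 P) (g : ι → H) :
    AEMeasurable (fun ω i => W (g i) ω) P :=
  aemeasurable_pi_iff.2 fun i => (Lp.aestronglyMeasurable (W (g i))).aemeasurable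

lemma IsIsonormal.map_dual (hW : IsIsonormal W) {ι : Type*} [Fintype ι] [DecidableEq ι]
    (g : ι → H) (L : StrongDual ℝ (ι → ℝ)) :
    (P.map fun ω i => W (g i) ω).map L
      = gaussianReal 0 (‖∑ i, L (Pi.single i 1) • g i‖₊ ^ 2) := by
  rw [← (hW.hasLaw_dual g L).map_eq,
    AEMeasurable.map_map_of_aemeasurable (by fun_prop) (aemeasurable_isonormal W g)]
  rfl

lemma IsIsonormal.isGaussianProcess (hW : IsIsonormal W) :
    IsGaussianProcess (fun h => ⇑(W h)) P where
  hasGaussianLaw I := by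
    classical
    exact ⟨isGaussian_of_map_eq_gaussianReal fun L =>
      ⟨_, _, hW.map_dual (fun h : I => (h : H)) L⟩⟩

lemma IsIsonormal.map_eq_of_inner_eq (hW : IsIsonormal W) {ι : Type*} [Finite ι] {g g' : ι → H}
    (hinner : ∀ i j, inner ℝ (g i) (g j) = inner ℝ (g' i) (g' j)) :
    (P.map fun ω i => W (g i) ω) = P.map fun ω i => W (g' i) ω := by
  classical
  have := Fintype.ofFinite ι
  have := hW.isGaussianProcess.isProbabilityMeasure
  have := Measure.isProbabilityMeasure_map (aemeasurable_isonormal W g)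
  have := Measure.isProbabilityMeasure_map (aemeasurable_isonormal W g')
  have hnorm : ∀ c : ι → ℝ, ‖∑ i, c i • g i‖₊ ^ 2 = ‖∑ i, c i • g' i‖₊ ^ 2 := fun c => by
    ext
    push_cast
    simp only [← real_inner_self_eq_norm_sq, sum_inner, inner_sum, real_inner_smul_left,
      real_inner_smul_right, hinner]
  refine Measure.ext_of_charFunDual (funext fun L => ?_)
  rw [charFunDual_eq_charFun_map_one, charFunDual_eq_charFun_map_one, hW.map_dual, hW.map_dual,
    hnorm]

lemma IsIsonormal.indepFun_of_inner_eq_zero (hW : IsIsonormal W) {S T : Type*} {g : S → H}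
    {g' : T → H} (horth : ∀ s t, inner ℝ (g s) (g' t) = 0) :
    (fun ω s => W (g s) ω) ⟂ᵢ[P] fun ω t => W (g' t) ω := by
  have := hW.isGaussianProcess.isProbabilityMeasure
  have hjoint : IsGaussianProcess (Sum.elim (fun s => ⇑(W (g s))) fun t => ⇑(W (g' t))) P := by
    convert! hW.isGaussianProcess.comp_right (Sum.elim g g') using 1
    ext (s | t) <;> rfl
  have hmeas : ∀ h, AEMeasurable (W h) P := fun h => (Lp.aestronglyMeasurable _).aemeasurable
  refine hjoint.indepFun_of_covariance_eq_zero (fun s => hmeas _) (fun t => hmeas _) fun s t => ?_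
  rw [covariance_eq_sub (Lp.memLp _) (Lp.memLp _), hW.integral_eq_zero, zero_mul, sub_zero]
  exact (integral_mul_eq_inner_isonormal W _ _).trans (horth s t)

end IsonormalJointLaws

end Isonormal

section MovingAverage

/-- The triangular covariance function `u ↦ (1 - |u|)₊` of the moving average process. -/
def triangle (u : ℝ) : ℝ := max (1 - |u|) 0

lemma triangle_nonneg (u : ℝ) : 0 ≤ triangle u := le_max_right _ _

lemma triangle_of_abs_le_one {u : ℝ} (hu : |u| ≤ 1) : triangle u = 1 - |u| :=
  max_eq_left (sub_nonneg.2 hu)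

lemma triangle_of_one_le_abs {u : ℝ} (hu : 1 ≤ |u|) : triangle u = 0 :=
  max_eq_right (sub_nonpos.2 hu)

lemma triangle_zero : triangle 0 = 1 := by simp [triangle]

lemma lipschitzWith_triangle : LipschitzWith 1 triangle := by
  refine LipschitzWith.of_dist_le_mul fun x y => ?_
  simp only [triangle, Real.dist_eq, NNReal.coe_one, one_mul]
  refine (abs_max_sub_max_le_abs _ _ _).trans ?_
  rw [sub_sub_sub_cancel_left, abs_sub_comm x y]
  exact abs_abs_sub_abs_le _ _

/-- The Hilbert space carrying `r` independent white noises on the line. -/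
abbrev WhiteNoiseSpace (r : ℕ) : Type :=
  Lp ℝ 2 ((volume : Measure ℝ).prod (Measure.count : Measure (Fin r)))

variable {r : ℕ}

lemma measure_unitWindow_ne_top (t : ℝ) (i : Fin r) :
    ((volume : Measure ℝ).prod (Measure.count : Measure (Fin r))) (Icc t (t + 1) ×ˢ {i}) ≠ ∞ := by
  rw [Measure.prod_prod]
  simp

/-- The indicator of the time window `[t, t + 1]` in the `i`-th noise. -/
noncomputable def unitWindow (t : ℝ) (i : Fin r) : WhiteNoiseSpace r :=
  indicatorConstLp 2 (s := Icc t (t + 1) ×ˢ {i})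
    (measurableSet_Icc.prod (measurableSet_singleton i)) (measure_unitWindow_ne_top t i) (1 : ℝ)

lemma volume_real_Icc_inter_Icc_add_one (s t : ℝ) :
    volume.real (Icc s (s + 1) ∩ Icc t (t + 1)) = triangle (t - s) := by
  rw [Icc_inter_Icc, Real.volume_real_Icc, triangle]
  congr 1
  change min (s + 1) (t + 1) - max s t = _
  rcases le_total s t with h | h
  · rw [min_eq_left (by linarith), max_eq_right h, abs_of_nonneg (by linarith)]; ring
  · rw [min_eq_right (by linarith), max_eq_left h, abs_of_nonpos (by linarith)]; ring

lemma inner_unitWindow (s t : ℝ) (i j : Fin r) :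
    inner ℝ (unitWindow s i) (unitWindow t j) = if i = j then triangle (t - s) else 0 := by
  rw [unitWindow, unitWindow, L2.real_inner_indicatorConstLp_one_indicatorConstLp_one _ _
      (measure_unitWindow_ne_top s i) (measure_unitWindow_ne_top t j),
    prod_inter_prod, measureReal_prod_prod, volume_real_Icc_inter_Icc_add_one]
  split_ifs with hij
  · subst hij
    simp [Measure.real]
  · rw [singleton_inter_eq_empty.2 (by simpa using hij)]
    simp

lemma norm_unitWindow (t : ℝ) (i : Fin r) : ‖unitWindow t i‖ = 1 := by
  rw [norm_eq_sqrt_real_inner, inner_unitWindow, if_pos rfl, sub_self, triangle_zero, Real.sqrt_one]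

variable {Ω : Type*} [MeasurableSpace Ω] {P : Measure Ω}

/-- The moving averages `X_t(i) = B_{t+1}(i) - B_t(i)` of `r` independent white noises: the noise
`W` is integrated over the window `[t, t + 1]`. -/
noncomputable def movingAverage (W : WhiteNoiseSpace r →ₗᵢ[ℝ] Lp ℝ 2 P) (t : ℝ) (ω : Ω) :
    Fin r → ℝ :=
  fun i => W (unitWindow t i) ω

variable {W : WhiteNoiseSpace r →ₗᵢ[ℝ] Lp ℝ 2 P}

lemma isGaussianProcess_movingAverage (hW : IsIsonormal W) :
    IsGaussianProcess (fun t : ℝ≥0 => movingAverage W t) P := by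
  classical
  refine hW.isGaussianProcess.of_isGaussianProcess fun t =>
    ⟨Finset.univ.image (unitWindow (r := r) t), ?_⟩
  refine ⟨ContinuousLinearMap.pi fun i =>
    .proj ⟨unitWindow (t : ℝ) i, Finset.mem_image_of_mem _ (Finset.mem_univ i)⟩, fun ω => ?_⟩
  rfl

lemma isStrictlyStationary_movingAverage (hW : IsIsonormal W) :
    IsStrictlyStationary P (movingAverage W) := by
  intro n t s _ _
  have hcurry : Measurable fun (x : Fin n × Fin r → ℝ) k i => x (k, i) := by fun_prop
  have hjoint := hW.map_eq_of_inner_eq (g := fun p : Fin n × Fin r => unitWindow (t p.1 + s) p.2)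
    (g' := fun p => unitWindow (t p.1) p.2) fun p q => by
      simp only [inner_unitWindow, add_sub_add_right_eq_sub]
  have := congrArg (Measure.map fun (x : Fin n × Fin r → ℝ) k i => x (k, i)) hjoint
  rwa [AEMeasurable.map_map_of_aemeasurable hcurry.aemeasurable (aemeasurable_isonormal W _),
    AEMeasurable.map_map_of_aemeasurable hcurry.aemeasurable (aemeasurable_isonormal W _)] at this

lemma integral_movingAverage_mul (W : WhiteNoiseSpace r →ₗᵢ[ℝ] Lp ℝ 2 P) (s t : ℝ) (i j : Fin r) :
    ∫ ω, movingAverage W s ω i * movingAverage W t ω j ∂P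
      = if i = j then triangle (t - s) else 0 :=
  (integral_mul_eq_inner_isonormal W _ _).trans (inner_unitWindow s t i j)

lemma laggedCov_movingAverage (hW : IsIsonormal W) (u : ℝ) (i j : Fin r) :
    laggedCov P (movingAverage W) u i j = if i = j then triangle u else 0 := by
  have hmean : ∫ ω, movingAverage W 0 ω i ∂P = 0 := hW.integral_eq_zero _
  rw [laggedCov, Matrix.of_apply, integral_movingAverage_mul, hmean, zero_mul, sub_zero, sub_zero]

lemma memLp_movingAverage (hW : IsIsonormal W) (t : ℝ) : MemLp (movingAverage W t) 4 P :=
  memLp_pi_iff.2 fun i => hW.memLp_four (unitWindow t i)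

lemma locallyLipschitz_laggedCov_movingAverage (hW : IsIsonormal W) (i j : Fin r) :
    LocallyLipschitz fun u => laggedCov P (movingAverage W) u i j := by
  simp only [laggedCov_movingAverage hW]
  split_ifs
  · exact lipschitzWith_triangle.locallyLipschitz
  · exact LocallyLipschitz.const 0

lemma integral_sq_lagMonomial_movingAverage_le (hW : IsIsonormal W) {U : Set ℝ} {G : Ω → ℝ}
    (hG : G ∈ lagMonomials (movingAverage W) U) : ∫ ω, G ω ^ 2 ∂P ≤ 3 := by
  rcases hG with ⟨s, -, i, rfl⟩ | ⟨s, -, t, -, i, j, rfl⟩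
  · simp only [sq, integral_movingAverage_mul, if_true, sub_self, triangle_zero]
    norm_num
  · have hpow : ∀ t (i : Fin r), ∫ ω, movingAverage W t ω i ^ 4 ∂P = 3 := fun t i =>
      (hW.integral_pow_four _).trans (by rw [norm_unitWindow]; norm_num)
    have h := integral_mul_sq_le ((memLp_movingAverage hW s).eval i)
      ((memLp_movingAverage hW t).eval j)
    rw [hpow, hpow] at h
    linarith

lemma indepFun_lagMonomials_movingAverage (hW : IsIsonormal W) {U V : Set ℝ}
    (hUV : ∀ s ∈ U, ∀ t ∈ V, 1 ≤ t - s) {G H : Ω → ℝ} (hG : G ∈ lagMonomials (movingAverage W) U)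
    (hH : H ∈ lagMonomials (movingAverage W) V) : G ⟂ᵢ[P] H := by
  obtain ⟨φ, hφ, rfl⟩ := exists_measurable_eq_of_mem_lagMonomials hG
  obtain ⟨ψ, hψ, rfl⟩ := exists_measurable_eq_of_mem_lagMonomials hH
  refine (hW.indepFun_of_inner_eq_zero (g := fun p : U × Fin r => unitWindow p.1 p.2)
    (g' := fun p : V × Fin r => unitWindow p.1 p.2) fun p q => ?_).comp hφ hψ
  rw [inner_unitWindow, triangle_of_one_le_abs ((hUV _ p.1.2 _ q.1.2).trans (le_abs_self _)),
    ite_self]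

lemma integrableOn_exp_sub_Ioi (a c : ℝ) : IntegrableOn (fun T => Real.exp (a - T)) (Ioi c) := by
  simpa only [IntegrableOn, ← Real.exp_add, ← sub_eq_add_neg] using
    (integrableOn_exp_neg_Ioi c).const_mul (Real.exp a)

/-- Windows at distance more than `1` are disjoint and so carry independent noise; at smaller
distances `T` the covariance is at most `3 ≤ 3 exp (1 - T)`. -/
lemma hasIntegrableDecorrelationRate_movingAverage [IsProbabilityMeasure P] (hW : IsIsonormal W) :
    HasIntegrableDecorrelationRate P (movingAverage W) fun T => 3 * Real.exp (1 - T) where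
  pos T _ := by positivity
  antitone a _ b _ hab := by
    beta_reduce
    gcongr
  continuous := by fun_prop
  integrable := (integrableOn_exp_sub_Ioi 1 1).const_mul 3
  decorrelation U V T _ _ _ _ _ _ _ hT G hG H hH := by
    have hG2 := memLp_two_of_mem_lagMonomials (fun t _ => memLp_movingAverage hW t) hG
    have hH2 := memLp_two_of_mem_lagMonomials (fun t _ => memLp_movingAverage hW t) hH
    refine (congrArg _ (covariance_eq_sub hG2 hH2).symm).trans_le ?_
    rcases le_total T 1 with hle | hge
    · have hexp := Real.one_le_exp (sub_nonneg.2 hle)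
      linarith [abs_covariance_le hG2 hH2, integral_sq_lagMonomial_movingAverage_le hW hG,
        integral_sq_lagMonomial_movingAverage_le hW hH]
    · have hind := indepFun_lagMonomials_movingAverage hW
        (fun s hs t ht => hge.trans (hT.1 ⟨s, hs, t, ht, rfl⟩)) hG hH
      rw [hind.covariance_eq_zero hG2 hH2, abs_zero]
      positivity

lemma isAdmissibleProcess_movingAverage [IsProbabilityMeasure P] (hW : IsIsonormal W) :
    IsAdmissibleProcess P (movingAverage W) fun T => 3 * Real.exp (1 - T) where
  stationary := isStrictlyStationary_movingAverage hW
  memLp t _ := memLp_movingAverage hW t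
  locallyLipschitz i j := (locallyLipschitz_laggedCov_movingAverage hW i j).locallyLipschitzOn
  decorrelation := hasIntegrableDecorrelationRate_movingAverage hW

end MovingAverage

section LowerBound

lemma triangle_le_exp_neg {x : ℝ} (hx : 0 ≤ x) : triangle x ≤ Real.exp (-x) := by
  rw [triangle, abs_of_nonneg hx]
  exact max_le (Real.one_sub_le_exp_neg x) (Real.exp_nonneg _)

lemma isDecayEnvelope_triangle : IsDecayEnvelope triangle where
  nonneg x _ := triangle_nonneg x
  antitoneOn x hx y hy hxy := by
    rw [triangle, triangle, abs_of_nonneg (mem_Ici.1 hx), abs_of_nonneg (mem_Ici.1 hy)]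
    gcongr
  integrableOn := (integrableOn_exp_neg_Ioi 0).mono'
    lipschitzWith_triangle.continuous.aestronglyMeasurable
    (ae_restrict_of_forall_mem measurableSet_Ioi fun x hx => by
      rw [Real.norm_of_nonneg (triangle_nonneg x)]
      exact triangle_le_exp_neg (le_of_lt hx))

lemma setIntegral_triangle_le_one : ∫ x in Ioi 0, triangle x ≤ 1 :=
  (setIntegral_mono_on isDecayEnvelope_triangle.integrableOn (integrableOn_exp_neg_Ioi 0)
    measurableSet_Ioi fun _ hx => triangle_le_exp_neg (le_of_lt hx)).trans_eq
      integral_exp_neg_Ioi_zero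

lemma triangle_mul_sub_mul (Δ a b : ℝ) :
    triangle (b * Δ - a * Δ) = triangle (|a - b| * Δ) := by
  rw [triangle, triangle, ← sub_mul, abs_mul, abs_mul, abs_abs, abs_sub_comm]

lemma sum_sum_triangle_le {Δ : ℝ} (hΔ : 0 < Δ) (hΔ1 : Δ ≤ 1) (N : ℕ) :
    ∑ a ∈ Finset.Icc 1 N, ∑ b ∈ Finset.Icc 1 N, triangle (b * Δ - a * Δ) ≤ 4 * N / Δ := by
  simp only [triangle_mul_sub_mul]
  calc ∑ a ∈ Finset.Icc 1 N, ∑ b ∈ Finset.Icc 1 N, triangle (|(a : ℝ) - b| * Δ)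
      ≤ N * (2 * (triangle 0 + (∫ x in Ioi 0, triangle x) / Δ)) :=
        isDecayEnvelope_triangle.sum_sum_le hΔ N
    _ ≤ N * (2 * (1 / Δ + 1 / Δ)) := by
        gcongr
        · exact triangle_zero.trans_le (one_le_one_div hΔ hΔ1)
        · exact setIntegral_triangle_le_one
    _ = 4 * N / Δ := by ring

lemma mul_le_sum_sum_of_le {N D : ℕ} (hD : D ≤ N) {F : ℕ → ℕ → ℝ} {c : ℝ}
    (hF : ∀ a b, 0 ≤ F a b) (hc : ∀ a b, a ≤ b → b ≤ a + D → c ≤ F a b) :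
    ((N : ℝ) - D) * ((D + 1) * c) ≤ ∑ a ∈ Finset.Icc 1 N, ∑ b ∈ Finset.Icc 1 N, F a b := by
  have hband : ∀ a ∈ Finset.Icc 1 (N - D), (D + 1) * c ≤ ∑ b ∈ Finset.Icc 1 N, F a b := by
    intro a ha
    rw [Finset.mem_Icc] at ha
    calc (D + 1) * c = ∑ _b ∈ Finset.Icc a (a + D), c := by
          rw [Finset.sum_const, Nat.card_Icc, nsmul_eq_mul, show a + D + 1 - a = D + 1 by lia]
          push_cast; rfl
      _ ≤ ∑ b ∈ Finset.Icc a (a + D), F a b := Finset.sum_le_sum fun b hb =>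
          hc a b (Finset.mem_Icc.1 hb).1 (Finset.mem_Icc.1 hb).2
      _ ≤ ∑ b ∈ Finset.Icc 1 N, F a b := Finset.sum_le_sum_of_subset_of_nonneg
          (Finset.Icc_subset_Icc ha.1 (by lia)) fun b _ _ => hF a b
  calc ((N : ℝ) - D) * ((D + 1) * c) = ∑ _a ∈ Finset.Icc 1 (N - D), (D + 1) * c := by
        rw [Finset.sum_const, Nat.card_Icc, nsmul_eq_mul, add_tsub_cancel_right, Nat.cast_sub hD]
    _ ≤ ∑ a ∈ Finset.Icc 1 (N - D), ∑ b ∈ Finset.Icc 1 N, F a b := Finset.sum_le_sum hband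
    _ ≤ ∑ a ∈ Finset.Icc 1 N, ∑ b ∈ Finset.Icc 1 N, F a b :=
        Finset.sum_le_sum_of_subset_of_nonneg (Finset.Icc_subset_Icc_right (N.sub_le D))
          fun a _ _ => Finset.sum_nonneg fun b _ => hF a b

/-- Each `a` has about `1 / (2 Δ)` indices `b` with `b Δ - a Δ ∈ [0, 1/2]`, where the triangle is at
least `1 / 2`. -/
lemma le_sum_sum_triangle_sq {N : ℕ} {Δ : ℝ} (hΔ : 0 < Δ) (hN : 1 ≤ N * Δ) :
    N / (16 * Δ)
      ≤ ∑ a ∈ Finset.Icc 1 N, ∑ b ∈ Finset.Icc 1 N, triangle (b * Δ - a * Δ) ^ 2 := by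
  set D := ⌊1 / (2 * Δ)⌋₊
  have hDΔ : D * Δ ≤ 1 / 2 := by
    have := Nat.floor_le (show 0 ≤ 1 / (2 * Δ) by positivity)
    rw [le_div_iff₀ (by positivity)] at this
    linarith
  have hDN : (D : ℝ) ≤ N / 2 := le_of_mul_le_mul_right (by linarith) hΔ
  have hhalf : ∀ a b : ℕ, a ≤ b → b ≤ a + D → 1 / 4 ≤ triangle (b * Δ - a * Δ) ^ 2 := by
    intro a b hab hba
    have hab' : (0 : ℝ) ≤ b - a := sub_nonneg.2 (by exact_mod_cast hab)
    have hba' : (b : ℝ) - a ≤ D := sub_le_iff_le_add'.2 (by exact_mod_cast hba)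
    have hgap : (b * Δ - a * Δ : ℝ) ≤ 1 / 2 := by
      rw [← sub_mul]
      exact (mul_le_mul_of_nonneg_right hba' hΔ.le).trans hDΔ
    have hgap0 : (0 : ℝ) ≤ b * Δ - a * Δ := by rw [← sub_mul]; positivity
    have : 1 / 2 ≤ triangle (b * Δ - a * Δ) := by
      rw [triangle_of_abs_le_one] <;> rw [abs_of_nonneg hgap0] <;> linarith
    nlinarith
  calc (N : ℝ) / (16 * Δ) = (N / 2) * ((1 / (2 * Δ)) * (1 / 4)) := by ring
    _ ≤ (N - D : ℝ) * ((D + 1) * (1 / 4)) := by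
        gcongr ?_ * (?_ * _)
        · linarith
        · linarith
        · exact (Nat.lt_floor_add_one _).le
    _ ≤ _ := mul_le_sum_sum_of_le
        (by exact_mod_cast (show (D : ℝ) ≤ N by linarith [Nat.cast_nonneg (α := ℝ) N]))
        (fun _ _ => sq_nonneg _) hhalf

variable {r : ℕ} {N : ℕ} {Δ u : ℝ}

/-- The element of the noise space that represents the empirical mean of the moving average. -/
noncomputable def meanWindow (N : ℕ) (Δ : ℝ) (κ : ℤ) (i : Fin r) : WhiteNoiseSpace r :=
  ∑ n ∈ Finset.Icc 1 N, (1 / (N : ℝ)) • unitWindow ((n + κ) * Δ) i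

lemma inner_meanWindow (N : ℕ) (Δ : ℝ) (κ κ' : ℤ) (i : Fin r) :
    inner ℝ (meanWindow N Δ κ i) (meanWindow N Δ κ' i) = (1 / (N : ℝ)) ^ 2 *
      ∑ a ∈ Finset.Icc 1 N, ∑ b ∈ Finset.Icc 1 N, triangle ((b + κ') * Δ - (a + κ) * Δ) := by
  rw [meanWindow, meanWindow, sum_inner, Finset.mul_sum]
  refine Finset.sum_congr rfl fun a _ => ?_
  rw [inner_sum, Finset.mul_sum]
  refine Finset.sum_congr rfl fun b _ => ?_
  rw [real_inner_smul_left, real_inner_smul_right, inner_unitWindow, if_pos rfl]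
  ring

lemma norm_meanWindow_sq_le (hΔ : 0 < Δ) (hΔ1 : Δ ≤ 1) (N : ℕ) (i : Fin r) :
    ‖meanWindow N Δ 0 i‖ ^ 2 ≤ 4 / (N * Δ) := by
  rw [← real_inner_self_eq_norm_sq, inner_meanWindow]
  simp only [Int.cast_zero, add_zero]
  calc _ ≤ (1 / (N : ℝ)) ^ 2 * (4 * N / Δ) := by gcongr; exact sum_sum_triangle_le hΔ hΔ1 N
    _ = 4 / (N * Δ) := by
        rcases eq_or_ne N 0 with rfl | hN
        · simp
        · field_simp

variable {Ω : Type*} [MeasurableSpace Ω] {P : Measure Ω}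
  {W : WhiteNoiseSpace r →ₗᵢ[ℝ] Lp ℝ 2 P}

lemma coeFn_meanWindow (W : WhiteNoiseSpace r →ₗᵢ[ℝ] Lp ℝ 2 P) (N : ℕ) (Δ : ℝ) (κ : ℤ)
    (i : Fin r) :
    W (meanWindow N Δ κ i) =ᵐ[P] fun ω => shiftedMean (movingAverage W) N Δ κ ω i := by
  rw [meanWindow, map_sum]
  simp only [map_smul, shiftedMean_apply, Finset.mul_sum]
  exact coeFn_sum_smul _ _ _

lemma integral_shiftedMean_mul_nonneg (W : WhiteNoiseSpace r →ₗᵢ[ℝ] Lp ℝ 2 P) (N : ℕ) (Δ : ℝ)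
    (κ κ' : ℤ) (i : Fin r) :
    0 ≤ ∫ ω, shiftedMean (movingAverage W) N Δ κ ω i
      * shiftedMean (movingAverage W) N Δ κ' ω i ∂P := by
  have hmean := (coeFn_meanWindow W N Δ κ i).fun_mul (coeFn_meanWindow W N Δ κ' i)
  rw [← integral_congr_ae hmean, integral_mul_eq_inner_isonormal, inner_meanWindow]
  exact mul_nonneg (sq_nonneg _) (Finset.sum_nonneg fun a _ => Finset.sum_nonneg fun b _ =>
    triangle_nonneg _)

lemma integral_shiftedMean_movingAverage_pow_four_le (hW : IsIsonormal W) (hΔ : 0 < Δ)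
    (hΔ1 : Δ ≤ 1) (N : ℕ) (i : Fin r) :
    ∫ ω, shiftedMean (movingAverage W) N Δ 0 ω i ^ 4 ∂P ≤ 48 / (N * Δ) ^ 2 := by
  have hmean : (fun ω => W (meanWindow N Δ 0 i) ω ^ 4)
      =ᵐ[P] fun ω => shiftedMean (movingAverage W) N Δ 0 ω i ^ 4 :=
    (coeFn_meanWindow W N Δ 0 i).fun_comp (· ^ 4)
  rw [← integral_congr_ae hmean]
  calc ∫ ω, W (meanWindow N Δ 0 i) ω ^ 4 ∂P = 3 * (‖meanWindow N Δ 0 i‖ ^ 2) ^ 2 := by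
        rw [hW.integral_pow_four]; ring
    _ ≤ 3 * (4 / (N * Δ)) ^ 2 := by gcongr; exact norm_meanWindow_sq_le hΔ hΔ1 N i
    _ = 48 / (N * Δ) ^ 2 := by ring

section Bias

variable [IsProbabilityMeasure P]

lemma integral_empiricalCov_movingAverage_le (hW : IsIsonormal W) (hΔ : 0 < Δ) (hN : N ≠ 0)
    (hu : 0 ≤ u) (i : Fin r) :
    ∫ ω, empiricalCov (movingAverage W) N Δ u ω i i ∂P ≤ triangle (round (u / Δ) * Δ) := by
  have hX := isAdmissibleProcess_movingAverage hW
  have hprod : ∀ n ∈ Finset.Icc 1 N, Integrable (fun ω => movingAverage W (n * Δ) ω i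
      * movingAverage W ((n + round (u / Δ)) * Δ) ω i) P := fun n _ =>
    (memLp_two_mul ((memLp_movingAverage hW _).eval i)
      ((memLp_movingAverage hW _).eval i)).integrable one_le_two
  have hmean : Integrable (fun ω => shiftedMean (movingAverage W) N Δ 0 ω i
      * shiftedMean (movingAverage W) N Δ (round (u / Δ)) ω i) P :=
    (memLp_two_mul (hX.memLp_shiftedMean hΔ N le_rfl i)
      (hX.memLp_shiftedMean hΔ N (round_div_nonneg hΔ hu) i)).integrable one_le_two
  simp only [empiricalCov_apply]
  rw [integral_sub ((integrable_finsetSum _ hprod).const_mul _) hmean, integral_const_mul,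
    integral_finsetSum _ hprod]
  refine (sub_le_self _ (integral_shiftedMean_mul_nonneg W N Δ _ _ i)).trans_eq ?_
  simp only [integral_movingAverage_mul, if_true, add_mul, add_sub_cancel_left, Finset.sum_const,
    Nat.card_Icc, add_tsub_cancel_right, nsmul_eq_mul]
  field_simp

lemma ofReal_abs_integral_le_eLpNorm_two {Y : Ω → ℝ} (hY : MemLp Y 2 P) :
    ENNReal.ofReal |∫ ω, Y ω ∂P| ≤ eLpNorm Y 2 P :=
  calc ENNReal.ofReal |∫ ω, Y ω ∂P| = ‖∫ ω, Y ω ∂P‖ₑ := by rw [← ofReal_norm, Real.norm_eq_abs]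
    _ ≤ eLpNorm Y 1 P := by
        rw [eLpNorm_one_eq_lintegral_enorm]
        exact enorm_integral_le_lintegral_enorm _
    _ ≤ eLpNorm Y 2 P := eLpNorm_le_eLpNorm_of_exponent_le one_le_two hY.1

/-- At the lag `3Δ/4`, which is rounded to `Δ`, the covariance `1 - 3Δ/4` is underestimated by at
least `Δ/4`. -/
lemma ofReal_div_four_le_covError_movingAverage (hW : IsIsonormal W) (i : Fin r) (hN : N ≠ 0)
    (hΔ : 0 < Δ) (hΔ1 : Δ ≤ 1) :
    ENNReal.ofReal (Δ / 4) ≤ covError P (movingAverage W) N Δ (3 / 4 * Δ) := by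
  have hround : round (3 / 4 * Δ / Δ) = 1 := by
    rw [mul_div_cancel_right₀ _ hΔ.ne', round_eq, Int.floor_eq_iff]
    norm_num
  have hmem := (isAdmissibleProcess_movingAverage hW).memLp_empiricalCov hΔ N
    (show 0 ≤ 3 / 4 * Δ by positivity) i i
  have hcov : laggedCov P (movingAverage W) (3 / 4 * Δ) i i = 1 - 3 / 4 * Δ := by
    have habs : |3 / 4 * Δ| = 3 / 4 * Δ := abs_of_pos (by positivity)
    rw [laggedCov_movingAverage hW, if_pos rfl, triangle_of_abs_le_one (by linarith), habs]
  have hmean := integral_empiricalCov_movingAverage_le hW hΔ hN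
    (show 0 ≤ 3 / 4 * Δ by positivity) i
  rw [hround, Int.cast_one, one_mul,
    triangle_of_abs_le_one (by rwa [abs_of_pos hΔ]), abs_of_pos hΔ] at hmean
  refine le_trans (ENNReal.ofReal_le_ofReal ?_) ((ofReal_abs_integral_le_eLpNorm_two
    (hmem.sub (memLp_const _))).trans (eLpNorm_apply_le_covError _ N Δ _ i i))
  refine le_trans ?_ (neg_le_abs _)
  simp only [Pi.sub_apply]
  rw [integral_sub (hmem.integrable one_le_two) (integrable_const _), hcov, integral_const,
    probReal_univ, one_smul]
  linarith

end Bias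

section Fluctuation

lemma memLp_movingAverage_sq (hW : IsIsonormal W) (t : ℝ) (i : Fin r) :
    MemLp (fun ω => movingAverage W t ω i ^ 2) 2 P := by
  have h := (memLp_movingAverage hW t).eval i
  simpa only [sq] using memLp_two_mul h h

variable [IsProbabilityMeasure P]

lemma covariance_movingAverage_sq (hW : IsIsonormal W) (s t : ℝ) (i : Fin r) :
    cov[fun ω => movingAverage W s ω i ^ 2, fun ω => movingAverage W t ω i ^ 2; P]
      = 2 * triangle (t - s) ^ 2 := by
  have hsq : ∀ t, ∫ ω, movingAverage W t ω i ^ 2 ∂P = 1 := fun t => by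
    simp only [sq, integral_movingAverage_mul, if_true, sub_self, triangle_zero]
  rw [covariance_eq_sub (memLp_movingAverage_sq hW s i) (memLp_movingAverage_sq hW t i), hsq, hsq]
  simp only [Pi.mul_apply, movingAverage]
  rw [hW.integral_sq_mul_sq, norm_unitWindow, norm_unitWindow, inner_unitWindow, if_pos rfl]
  ring

lemma le_variance_mean_movingAverage_sq (hW : IsIsonormal W) (i : Fin r) (hΔ : 0 < Δ)
    (hN : 1 ≤ N * Δ) :
    1 / (8 * (N * Δ))
      ≤ Var[fun ω => 1 / (N : ℝ) * ∑ n ∈ Finset.Icc 1 N, movingAverage W (n * Δ) ω i ^ 2; P] := by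
  have hN0 : (N : ℝ) ≠ 0 := by rintro h; rw [h] at hN; linarith
  rw [variance_const_mul, variance_fun_sum' fun n _ => memLp_movingAverage_sq hW _ i]
  simp only [covariance_movingAverage_sq hW, ← Finset.mul_sum]
  calc 1 / (8 * (N * Δ)) = (1 / (N : ℝ)) ^ 2 * (2 * (N / (16 * Δ))) := by field_simp; norm_num
    _ ≤ _ := by gcongr; exact le_sum_sum_triangle_sq hΔ hN

lemma variance_add_le {Y Z : Ω → ℝ} (hY : MemLp Y 2 P) (hZ : MemLp Z 2 P) (b : ℝ) :
    Var[fun ω => Y ω + Z ω; P] ≤ 2 * (∫ ω, (Y ω - b) ^ 2 ∂P + ∫ ω, Z ω ^ 2 ∂P) := by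
  have hYb : MemLp (fun ω => Y ω - b) 2 P := hY.sub (memLp_const b)
  calc Var[fun ω => Y ω + Z ω; P] = Var[fun ω => Y ω + Z ω - b; P] :=
        (variance_sub_const (hY.add hZ).1 b).symm
    _ ≤ ∫ ω, (Y ω + Z ω - b) ^ 2 ∂P :=
        variance_le_expectation_sq ((hY.add hZ).sub (memLp_const b)).1
    _ ≤ ∫ ω, 2 * ((Y ω - b) ^ 2 + Z ω ^ 2) ∂P :=
        integral_mono ((hY.add hZ).sub (memLp_const b)).integrable_sq
          ((hYb.integrable_sq.add hZ.integrable_sq).const_mul 2) fun ω => by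
            simp only
            linarith [sq_nonneg (Y ω - b - Z ω)]
    _ = _ := by rw [integral_const_mul, integral_add hYb.integrable_sq hZ.integrable_sq]

lemma le_integral_sq_empiricalCov_movingAverage (hW : IsIsonormal W) (i : Fin r) (hΔ : 0 < Δ)
    (hΔ1 : Δ ≤ 1) (hN : 1536 ≤ N * Δ) :
    1 / (32 * (N * Δ)) ≤ ∫ ω, (empiricalCov (movingAverage W) N Δ 0 ω i i - 1) ^ 2 ∂P := by
  have hX := isAdmissibleProcess_movingAverage hW
  have hmean := hX.memLp_shiftedMean hΔ N le_rfl i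
  have hsplit : ∀ ω, 1 / (N : ℝ) * ∑ n ∈ Finset.Icc 1 N, movingAverage W (n * Δ) ω i ^ 2
      = empiricalCov (movingAverage W) N Δ 0 ω i i
        + shiftedMean (movingAverage W) N Δ 0 ω i * shiftedMean (movingAverage W) N Δ 0 ω i :=
    fun ω => by
      simp only [empiricalCov_apply, zero_div, round_zero, Int.cast_zero, add_zero,
        sub_add_cancel, sq]
  have hvar := le_variance_mean_movingAverage_sq hW i hΔ (by linarith : 1 ≤ N * Δ)
  simp only [hsplit] at hvar
  have hle := hvar.trans (variance_add_le (hX.memLp_empiricalCov hΔ N le_rfl i i)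
    (memLp_two_mul hmean hmean) 1)
  have hpow := integral_shiftedMean_movingAverage_pow_four_le hW hΔ hΔ1 N i
  simp only [← sq, ← pow_mul] at hle
  have hsmall : 48 / (N * Δ) ^ 2 ≤ 1 / (32 * (N * Δ)) := by
    rw [div_le_div_iff₀ (by positivity) (by positivity)]
    nlinarith
  have hrel : 1 / (8 * (N * Δ)) = 4 * (1 / (32 * (N * Δ))) := by field_simp; norm_num
  linarith

lemma ofReal_sqrt_le_covError_movingAverage (hW : IsIsonormal W) (i : Fin r) (hΔ : 0 < Δ)
    (hΔ1 : Δ ≤ 1) (hN : 1536 ≤ N * Δ) :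
    ENNReal.ofReal √(1 / (32 * (N * Δ))) ≤ covError P (movingAverage W) N Δ 0 := by
  refine le_trans ?_ (eLpNorm_apply_le_covError _ N Δ _ i i)
  rw [laggedCov_movingAverage hW, if_pos rfl, triangle_zero]
  have hmem : MemLp (fun ω => empiricalCov (movingAverage W) N Δ 0 ω i i - 1) 2 P :=
    ((isAdmissibleProcess_movingAverage hW).memLp_empiricalCov hΔ N le_rfl i i).sub (memLp_const 1)
  rw [← ENNReal.pow_le_pow_left_iff two_ne_zero]
  refine le_trans ?_ (eLpNorm_pow_eq_ofReal_integral_pow even_two two_ne_zero hmem).ge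
  rw [← ENNReal.ofReal_pow (Real.sqrt_nonneg _), Real.sq_sqrt (by positivity)]
  exact ENNReal.ofReal_le_ofReal (le_integral_sq_empiricalCov_movingAverage hW i hΔ hΔ1 hN)

end Fluctuation

/-- With `N = y³`, the bias `Δ / 4` is of order at least `1 / y` if `Δ ≥ 1 / y`, and the standard
deviation, of order `1 / √(N Δ)`, is so if `Δ ≤ 1 / y`. -/
lemma eventually_le_covError_movingAverage [IsProbabilityMeasure P] (hW : IsIsonormal W)
    (i : Fin r) {A : ℝ} (hA : 0 < A) {N : ℝ → ℕ} {Δ : ℝ → ℝ} (h : IsAdaptiveScheme N Δ) :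
    ∀ᶠ ε in 𝓝[>] (0 : ℝ), ∃ u ∈ Icc 0 A,
      ENNReal.ofReal (1 / 8 * (1 / (N ε : ℝ) ^ (1 / 3 : ℝ)))
        ≤ covError P (movingAverage W) (N ε) (Δ ε) u := by
  filter_upwards [self_mem_nhdsWithin, h.tendsto_zero.eventually_lt_const hA,
    h.tendsto_zero.eventually_lt_const zero_lt_one,
    h.tendsto_atTop.eventually_ge_atTop 1536] with ε hε hΔA hΔ1 hNΔ
  have hΔ := h.pos ε hε
  have hN : N ε ≠ 0 := by rintro hN; norm_num [hN] at hNΔ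
  have hy : 0 < (N ε : ℝ) ^ (1 / 3 : ℝ) := by positivity
  have hy3 := cast_eq_rpow_third_pow (N ε)
  set y := (N ε : ℝ) ^ (1 / 3 : ℝ)
  have : 0 < 1 / y := by positivity
  rcases le_total (1 / y) (Δ ε) with hcoarse | hfine
  · refine ⟨3 / 4 * Δ ε, ⟨by positivity, by linarith⟩, le_trans (ENNReal.ofReal_le_ofReal ?_)
      (ofReal_div_four_le_covError_movingAverage hW i hN hΔ hΔ1.le)⟩
    linarith
  · refine ⟨0, ⟨le_rfl, hA.le⟩, le_trans (ENNReal.ofReal_le_ofReal (Real.le_sqrt_of_sq_le ?_))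
      (ofReal_sqrt_le_covError_movingAverage hW i hΔ hΔ1.le hNΔ)⟩
    calc (1 / 8 * (1 / y)) ^ 2 = 1 / (64 * (y ^ 3 * (1 / y))) := by field_simp; norm_num
      _ ≤ 1 / (64 * (N ε * Δ ε)) := by rw [hy3]; gcongr
      _ ≤ 1 / (32 * (N ε * Δ ε)) := by gcongr; norm_num

end LowerBound

theorem mainTheorem6 (r : ℕ) :
    -- the upper bound, for every scheme with `Δ(ε) ~ N(ε)^{-1/3}`
    (∀ (A I c : ℝ) (ν L : ℝ≥0), 0 < c →
      ∃ C : ℝ, 0 < C ∧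
        ∀ (Ω : Type v) [MeasurableSpace Ω] (P : Measure Ω) [IsProbabilityMeasure P]
          (X : ℝ → Ω → Fin r → ℝ) (f : ℝ → ℝ),
          IsAdmissibleProcess P X f →
          eLpNorm (X 0) 4 P ≤ ν →
          (∫ T in Ioi (1 : ℝ), f T) ≤ I →
          (∀ i j, LipschitzOnWith L (fun u => laggedCov P X u i j) (Icc 0 (A + 1))) →
          ∀ (N : ℝ → ℕ) (Δ : ℝ → ℝ),
            (∀ ε, 0 < ε → 0 < Δ ε) →
            Tendsto N (𝓝[>] 0) atTop →
            Tendsto (fun ε => Δ ε / (1 / (N ε : ℝ) ^ (1 / 3 : ℝ))) (𝓝[>] 0) (𝓝 c) →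
            ∀ᶠ ε in 𝓝[>] (0 : ℝ), ∀ u ∈ Icc 0 A,
              covError P X (N ε) (Δ ε) u ≤ ENNReal.ofReal (C * (1 / (N ε : ℝ) ^ (1 / 3 : ℝ)))) ∧
    -- optimality: a Gaussian process for which no scheme does better, uniformly on `[0, A]`
    (0 < r →
      ∃ (Ω : Type) (_ : MeasurableSpace Ω) (P : Measure Ω) (_ : IsProbabilityMeasure P)
        (X : ℝ → Ω → Fin r → ℝ) (f : ℝ → ℝ),
        IsAdmissibleProcess P X f ∧
        IsGaussianProcess (fun t : ℝ≥0 => X t) P ∧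
        ∀ A : ℝ, 0 < A →
          ∃ c : ℝ, 0 < c ∧
            ∀ (N : ℝ → ℕ) (Δ : ℝ → ℝ), IsAdaptiveScheme N Δ →
              ∀ᶠ ε in 𝓝[>] (0 : ℝ), ∃ u ∈ Icc 0 A,
                ENNReal.ofReal (c * (1 / (N ε : ℝ) ^ (1 / 3 : ℝ))) ≤
                  covError P X (N ε) (Δ ε) u) := by
  refine ⟨fun A I c ν L hc =>
    ⟨r ^ 2 * balancedRateConst (noncentredFluctuationConst A I ν) L c + 1,
      by unfold balancedRateConst; positivity,
      fun Ω _ P _ X f hX hν hI hL N Δ hΔ hN hΔN => ?_⟩, fun hr => ?_⟩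
  · filter_upwards [hX.eventually_covError_le hc hν hI hL hΔ hN hΔN] with ε hε u hu
    refine (hε u hu).trans (ENNReal.ofReal_le_ofReal ?_)
    gcongr
    exact le_add_of_nonneg_right zero_le_one
  · obtain ⟨Ω, mΩ, P, hP, W, hW⟩ := exists_isonormal (WhiteNoiseSpace r)
    exact ⟨Ω, mΩ, P, hP, movingAverage W, _, isAdmissibleProcess_movingAverage hW,
      isGaussianProcess_movingAverage hW, fun A hA => ⟨1 / 8, by norm_num, fun N Δ h =>
        eventually_le_covError_movingAverage hW ⟨0, hr⟩ hA h⟩⟩
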